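/- A modular ortholattice (MOL) is a modular lattice $L$ with bounds $0,1$ and a unary operation $a\mapsto a'$ such that $a+a'=1$, $aa'=0$, $a''=a$, and $a\le b$ implies $b'\le a'$ (joins are written $a+b$, meets $ab$). It is finite-dimensional if it has a finite maximal chain, and atomic if every $a>0$ lies above an atom. A projective space is a set $P$ of points with a set of $3$-element subsets, the collinear triplets, such that: if $p,q,r$ are distinct points not forming a collinear triplet, and $\{p,s,q\}$ and $\{q,t,r\}$ are collinear triplets, then there is a unique point $u$ such that $\{p,r,u\}$ and $\{s,t,u\}$ are collinear triplets. A subspace is a set $U\subseteq P$ that contains $r$ whenever $\{p,q,r\}$ is a collinear triplet with $p,q\in U$; the subspaces, ordered by inclusion, form a lattice $\mathcal S(P)$, and points are identified with singleton subspaces. An orthogonality on $P$ is a symmetric relation $\perp$ on $P$ such that $p\perp q$, $p\perp r$ and $s\le q+r$ imply $p\perp s$; for subspaces, $U\perp V$ means that $p\perp q$ for all $p\in U$, $q\in V$, and $U^\perp$ is the subspace of all points orthogonal to all points of $U$. It is anisotropic if $p\not\perp p$ for every point $p$. It is a polarity if for every point $p$ there is a point $q$ with $p\not\perp q$, and $p^\perp$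 is a coatom of $\mathcal S(P)$ for every point $p$. Theorem. For every modular ortholattice $L$ the following are equivalent: 1. $L$ is proatomic, i.e. $L$ belongs to the variety (equational class) generated by the finite-dimensional MOLs: $L$ satisfies every identity in the operations $+,\cdot,{}',0,1$ that holds in all finite-dimensional MOLs. 2. $L$ has an atomic MOL-extension, i.e. $L$ is isomorphic to a subalgebra (with respect to $+,\cdot,{}',0,1$) of an atomic MOL. 3. $L$ has a geometric representation, i.e. there are a projective space $P$ with an anisotropic polarity $\perp$ and an injective lattice homomorphism $\eta:L\to\mathcal S(P)$ preserving $0$ and $1$ such that $\eta(a)\perp\eta(a')$ for all $a\in L$ (by modularity of $\mathcal S(P)$, this means $\eta(a')=\eta(a)^\perp$ for all $a\in L$). -/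

import Mathlib

universe u

namespace MOL

/-- An ortholattice: a bounded lattice with an orthocomplementation, written `aᶜ`. -/
class Ortholattice (L : Type u) extends Lattice L, BoundedOrder L, Compl L where
  sup_compl_self : ∀ x : L, x ⊔ xᶜ = ⊤
  inf_compl_self : ∀ x : L, x ⊓ xᶜ = ⊥
  compl_compl_self : ∀ x : L, xᶜᶜ = x
  compl_antitone : ∀ x y : L, x ≤ y → yᶜ ≤ xᶜ

/-- A modular ortholattice (MOL). -/
class ModularOrtholattice (L : Type u) extends Ortholattice L, IsModularLattice L

/-- The height (the minimal length of a maximal chain) of the lattice is finite: there is a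
finite maximal chain. -/
def IsFiniteDimensional (L : Type u) [Lattice L] : Prop :=
  ∃ c : Set L, c.Finite ∧ IsMaxChain (· ≤ ·) c

/-! ### Varieties -/

/-- Terms in the signature `(+, ·, ', 0, 1)` of ortholattices, with variables indexed by `ℕ`. -/
inductive OrthoTerm : Type
  | var : ℕ → OrthoTerm
  | zero : OrthoTerm
  | one : OrthoTerm
  | join : OrthoTerm → OrthoTerm → OrthoTerm
  | meet : OrthoTerm → OrthoTerm → OrthoTerm
  | compl : OrthoTerm → OrthoTerm

/-- The value of a term under an assignment of its variables. -/
def OrthoTerm.eval {L : Type u} [Ortholattice L] (v : ℕ → L) : OrthoTerm → L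
  | .var n => v n
  | .zero => ⊥
  | .one => ⊤
  | .join s t => s.eval v ⊔ t.eval v
  | .meet s t => s.eval v ⊓ t.eval v
  | .compl s => (s.eval v)ᶜ

/-- The identity `s = t` holds in `L`. -/
def Satisfies (L : Type u) [Ortholattice L] (s t : OrthoTerm) : Prop :=
  ∀ v : ℕ → L, s.eval v = t.eval v

/-- `L` lies in the variety (equational class) generated by the finite-dimensional MOLs: it
satisfies every identity that holds in all finite-dimensional MOLs. -/
def IsProatomic (L : Type u) [ModularOrtholattice L] : Prop :=
  ∀ s t : OrthoTerm,
    (∀ (M : Type u) [ModularOrtholattice M], IsFiniteDimensional M → Satisfies M s t) →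
      Satisfies L s t

/-! ### Atomic extensions -/

/-- `L` is, up to isomorphism, a subalgebra of an atomic MOL: it embeds into one by an injective
map preserving joins, meets, `0`, `1` and the orthocomplementation. -/
def HasAtomicExtension (L : Type u) [ModularOrtholattice L] : Prop :=
  ∃ (M : Type u) (_ : ModularOrtholattice M) (f : BoundedLatticeHom L M),
    IsAtomic M ∧ Function.Injective f ∧ ∀ a : L, f aᶜ = (f a)ᶜ

/-! ### Projective spaces and their subspaces -/

/-- A projective space: a set of points with a set of collinear triplets, which are 3-element
subsets (given here as a totally symmetric relation between distinct points), satisfying the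
triangle axiom. The space may be reducible. -/
class ProjectiveSpace (P : Type u) where
  Collinear : P → P → P → Prop
  ne_of_collinear : ∀ {p q r : P}, Collinear p q r → p ≠ q
  collinear_swap : ∀ {p q r : P}, Collinear p q r → Collinear q p r
  collinear_rotate : ∀ {p q r : P}, Collinear p q r → Collinear q r p
  triangle : ∀ {p q r s t : P}, Collinear p s q → Collinear q t r → p ≠ r →
    ¬ Collinear p q r → ∃! u : P, Collinear p r u ∧ Collinear s t u

/-- A subspace of a projective space. -/
@[ext]
structure ProjSubspace (P : Type u) [ProjectiveSpace P] where
  carrier : Set P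
  closed : ∀ {p q r : P}, p ∈ carrier → q ∈ carrier →
    ProjectiveSpace.Collinear p q r → r ∈ carrier

namespace ProjSubspace

variable {P : Type u} [ProjectiveSpace P]

instance : SetLike (ProjSubspace P) P where
  coe := carrier
  coe_injective _ _ h := ProjSubspace.ext h

/-- Subspaces are ordered by inclusion. -/
instance : PartialOrder (ProjSubspace P) := PartialOrder.ofSetLike (ProjSubspace P) P

instance : InfSet (ProjSubspace P) where
  sInf S :=
    { carrier := {p | ∀ U ∈ S, p ∈ U}
      closed := fun hp hq h U hU => U.closed (hp U hU) (hq U hU) h }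

theorem isGLB_sInf (S : Set (ProjSubspace P)) : IsGLB S (sInf S) :=
  ⟨fun U hU _ hp => hp U hU, fun _ hV _ hp _ hU => hV hU hp⟩

/-- The lattice of all subspaces: the order is inclusion and meets are intersections (so the
join of two subspaces is the least subspace that contains both). -/
instance : CompleteLattice (ProjSubspace P) where
  __ := completeLatticeOfInf (ProjSubspace P) isGLB_sInf
  inf U V :=
    { carrier := {p | p ∈ U ∧ p ∈ V}
      closed := fun hp hq h => ⟨U.closed hp.1 hq.1 h, V.closed hp.2 hq.2 h⟩ }
  inf_le_left _ _ _ hp := hp.1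
  inf_le_right _ _ _ hp := hp.2
  le_inf _ _ _ h₁ h₂ _ hp := ⟨h₁ hp, h₂ hp⟩
  top := ⟨Set.univ, fun _ _ _ => trivial⟩
  le_top _ _ _ := trivial
  bot := ⟨∅, fun hp _ _ => hp.elim⟩
  bot_le _ _ hp := hp.elim

/-- A point, regarded as a singleton subspace. -/
def point (p : P) : ProjSubspace P where
  carrier := {p}
  closed hq hr h := absurd (hq.trans hr.symm) (ProjectiveSpace.ne_of_collinear h)

theorem mem_point_sup_point {p q r : P} (h : ProjectiveSpace.Collinear p q r) :
    point r ≤ point p ⊔ point q := by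
  rintro x rfl
  exact (point p ⊔ point q).closed ((le_sup_left : point p ≤ point p ⊔ point q) rfl)
    ((le_sup_right : point q ≤ point p ⊔ point q) rfl) h

end ProjSubspace

/-! ### Orthogonalities and polarities -/

open ProjSubspace in
/-- An orthogonality on (the set of points of) a projective space. -/
structure Orthogonality (P : Type u) [ProjectiveSpace P] where
  Perp : P → P → Prop
  symm : ∀ {p q : P}, Perp p q → Perp q p
  perp_of_le_sup : ∀ {p q r s : P}, Perp p q → Perp p r →
    point s ≤ point q ⊔ point r → Perp p s

namespace Orthogonality

variable {P : Type u} [ProjectiveSpace P] (o : Orthogonality P)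

/-- The orthogonality of subspaces: all points of `U` are orthogonal to all points of `V`. -/
def SubspacePerp (U V : ProjSubspace P) : Prop :=
  ∀ p ∈ U, ∀ q ∈ V, o.Perp p q

/-- The subspace `U^⊥` of all points orthogonal to `U`. -/
def orth (U : ProjSubspace P) : ProjSubspace P where
  carrier := {q | ∀ p ∈ U, o.Perp p q}
  closed hq hr h p hp :=
    o.perp_of_le_sup (hq p hp) (hr p hp) (ProjSubspace.mem_point_sup_point h)

/-- No point is orthogonal to itself. -/
def IsAnisotropic : Prop :=
  ∀ p : P, ¬ o.Perp p p

/-- A polarity: a nondegenerate orthogonality such that `p^⊥` is a coatom of the subspace lattice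
for each point `p`. -/
def IsPolarity : Prop :=
  (∀ p : P, ∃ q : P, ¬ o.Perp p q) ∧ ∀ p : P, IsCoatom (o.orth (ProjSubspace.point p))

end Orthogonality

/-- `L` has a geometric representation: an embedding of bounded lattices into the subspace
lattice of a projective space with an anisotropic polarity, such that the image of `a` is
orthogonal to the image of `aᶜ` for all `a`. -/
def HasGeometricRepresentation (L : Type u) [ModularOrtholattice L] : Prop :=
  ∃ (P : Type u) (_ : ProjectiveSpace P) (o : Orthogonality P)
    (η : BoundedLatticeHom L (ProjSubspace P)),
    o.IsPolarity ∧ o.IsAnisotropic ∧ Function.Injective η ∧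
      ∀ a : L, o.SubspacePerp (η a) (η aᶜ)

end MOL

/-! Everything passes through atomic ortholattices. The recurrent tool is that an atom below `a + b`
lies below `q + r` for atoms `q ≤ a`, `r ≤ b`, unless it is already below `a` or `b`
(`exists_atoms_of_le_sup`).

2 → 3: the points are the atoms of the extension, and an element goes to the set of atoms below it;
the tool makes this map preserve joins.

3 → 2: the represented subspaces split the space, `X + X^⊥ = 1`. Adjoin all subspaces obtained from
them by finitely many joins with points and meets with `p^⊥`. These still split, and they are closed
under joins because `(X ∩ p^⊥) + Y` is `X + Y` or `(X + Y) ∩ y^⊥` for some point `y`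
(`SplittingPair.inf_orth_point_sup`). The result is an MOL that contains every point, so it is
atomic.

2 → 1: since `s ≤ t` iff `s(st)' = 0`, only vanishing of terms matters. An atom below the value of a
term is there because of finitely many atoms, so it survives cutting the assignment down to the
interval below a finite join of atoms, which is finite-dimensional (`holdsAboveAtoms_le_eval`).

1 → 2: by an ultraproduct over finite subsets it suffices to model a sequence `v` in `L`
(`IsProatomic.exists_isAtomic_eval`). Let `A k` be increasing joins of the terms vanishing at `v`.
For each `k` some atomic model keeps `b (A k)'` nonzero for every term `b` not vanishing at `v`. In
an ultraproduct of these models keep only the atoms orthogonal to all values of terms vanishing at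
`v`. By saturation there is one below each nonvanishing term, and those below a join of terms split
into atoms of the same kind. This represents the subalgebra generated by `v` geometrically, and the
construction of 3 → 2 yields an atomic MOL. -/

namespace MOL

/-! ### Ortholattices -/

section Ortholattice

variable {L : Type*} [Ortholattice L] {x y z : L}

open Ortholattice

theorem compl_le_compl' (h : x ≤ y) : yᶜ ≤ xᶜ := compl_antitone _ _ h

theorem le_compl_comm' (h : x ≤ yᶜ) : y ≤ xᶜ := by
  simpa [compl_compl_self] using compl_le_compl' h

theorem compl_sup_eq (x y : L) : (x ⊔ y)ᶜ = xᶜ ⊓ yᶜ :=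
  le_antisymm (le_inf (compl_le_compl' le_sup_left) (compl_le_compl' le_sup_right))
    (le_compl_comm' (sup_le (le_compl_comm' inf_le_left) (le_compl_comm' inf_le_right)))

theorem compl_inf_eq (x y : L) : (x ⊓ y)ᶜ = xᶜ ⊔ yᶜ := by
  rw [← compl_compl_self (xᶜ ⊔ yᶜ), compl_sup_eq, compl_compl_self, compl_compl_self]

theorem compl_bot_eq : (⊥ : L)ᶜ = ⊤ := by
  simpa using sup_compl_self (⊥ : L)

theorem compl_top_eq : (⊤ : L)ᶜ = ⊥ := by
  simpa using inf_compl_self (⊤ : L)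

theorem not_le_compl_of_isAtom (hx : IsAtom x) : ¬ x ≤ xᶜ := fun h =>
  hx.1 (by rw [← inf_compl_self x, inf_eq_left.2 h])

end Ortholattice

section ModularOrtholattice

variable {L : Type*} [ModularOrtholattice L] {x y z : L}

open Ortholattice

theorem sup_inf_compl_of_le (h : z ≤ x) : z ⊔ x ⊓ zᶜ = x := by
  rw [inf_comm, ← sup_inf_assoc_of_le _ h, sup_compl_self, top_inf_eq]

theorem inf_compl_inf_compl_of_le (h : z ≤ x) : x ⊓ (x ⊓ zᶜ)ᶜ = z := by
  rw [compl_inf_eq, compl_compl_self, sup_comm, inf_comm, sup_inf_assoc_of_le _ h, inf_comm,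
    Ortholattice.inf_compl_self, sup_bot_eq]

theorem le_of_inf_compl_inf_eq_bot (h : x ⊓ (x ⊓ y)ᶜ = ⊥) : x ≤ y := by
  have := sup_inf_compl_of_le (inf_le_left : x ⊓ y ≤ x)
  rw [h, sup_bot_eq] at this
  exact inf_eq_left.1 this

end ModularOrtholattice

/-! ### Atoms of modular lattices -/

section Atoms

variable {L : Type*} [Lattice L] [BoundedOrder L] [IsModularLattice L] {a b p q x s t : L}

theorem covBy_sup_of_isAtom (hx : IsAtom x) (h : ¬ x ≤ a) : a ⋖ a ⊔ x := by
  apply covBy_sup_of_inf_covBy_right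
  rwa [((hx.not_le_iff_disjoint).1 h).symm.eq_bot, bot_covBy_iff]

theorem exchange (hx : IsAtom x) (hp : p ≤ a ⊔ x) (hpa : ¬ p ≤ a) : x ≤ a ⊔ p := by
  have hxa : ¬ x ≤ a := fun h => hpa (hp.trans (sup_le le_rfl h))
  by_contra hne
  refine (covBy_sup_of_isAtom hx hxa).2 (left_lt_sup.2 hpa) ?_
  refine lt_of_le_of_ne (sup_le le_sup_left hp) fun h => hne (h ▸ le_sup_right)

theorem sup_eq_sup_of_exchange (hx : IsAtom x) (hp : p ≤ a ⊔ x) (hpa : ¬ p ≤ a) :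
    a ⊔ p = a ⊔ x :=
  le_antisymm (sup_le le_sup_left hp) (sup_le le_sup_left (exchange hx hp hpa))

theorem isAtom_of_sup_covBy (h : b ⋖ b ⊔ x) (hd : b ⊓ x = ⊥) : IsAtom x := by
  rw [← bot_covBy_iff, ← hd]
  exact inf_covBy_of_covBy_sup_left h

theorem sup_inf_sup_of_le {L : Type*} [Lattice L] [IsModularLattice L] {a s t : L}
    (ht : t ≤ s ⊔ a) : s ⊔ a ⊓ (s ⊔ t) = s ⊔ t := by
  rw [← sup_inf_assoc_of_le _ le_sup_left, inf_eq_right]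
  exact sup_le le_sup_left ht

/-- By modularity `s + a(s + t) = s + t`, which covers `s`; transposing this cover down to `[0, a(s
+ t)]` gives the atom. -/
theorem isAtom_inf_sup (hs : IsAtom s) (ht : IsAtom t) (hts : t ≤ s ⊔ a) (hne : t ≠ s)
    (hsa : ¬ s ≤ a) : IsAtom (a ⊓ (s ⊔ t)) := by
  apply isAtom_of_sup_covBy (b := s)
  · rw [sup_inf_sup_of_le hts]
    exact covBy_sup_of_isAtom ht fun h => hne ((hs.le_iff.1 h).resolve_left ht.1)
  · rw [← inf_assoc, (hs.not_le_iff_disjoint.1 hsa).eq_bot, bot_inf_eq]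

end Atoms

/-- The relative complement `x` of `ab` in `a(p + b)` satisfies `b + x = b + p` and `bx = 0`, so it
is perspective to `p` and hence an atom. The second atom is the intersection of `b` with the line `x
+ p`. No atomicity of the lattice is needed. -/
theorem exists_atoms_of_le_sup {L : Type*} [ModularOrtholattice L] {a b p : L} (hp : IsAtom p)
    (hab : p ≤ a ⊔ b) (ha : ¬ p ≤ a) (hb : ¬ p ≤ b) :
    ∃ q r, IsAtom q ∧ IsAtom r ∧ q ≤ a ∧ r ≤ b ∧ p ≤ q ⊔ r := by
  set x := a ⊓ (p ⊔ b) ⊓ (a ⊓ b)ᶜ with hx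
  have h1 : a ⊓ b ⊔ x = a ⊓ (p ⊔ b) :=
    sup_inf_compl_of_le (inf_le_inf_left a le_sup_right)
  have h2 : b ⊔ x = b ⊔ p := by
    calc b ⊔ x = b ⊔ (a ⊓ b) ⊔ x := by rw [sup_eq_left.2 (inf_le_right : a ⊓ b ≤ b)]
      _ = b ⊔ a ⊓ (b ⊔ p) := by rw [sup_assoc, h1, sup_comm p b]
      _ = b ⊔ p := sup_inf_sup_of_le (by rwa [sup_comm])
  have h3 : b ⊓ x = ⊥ := by
    rw [← le_bot_iff, ← Ortholattice.inf_compl_self (a ⊓ b)]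
    exact le_inf (le_inf (inf_le_right.trans (inf_le_left.trans inf_le_left)) inf_le_left)
      (inf_le_right.trans inf_le_right)
  have hxa : IsAtom x := isAtom_of_sup_covBy (h2 ▸ covBy_sup_of_isAtom hp hb) h3
  have hxb : ¬ x ≤ b := fun h => hxa.1 (by rwa [inf_eq_right.2 h] at h3)
  have hpx : p ≤ x ⊔ b := by rw [sup_comm, h2]; exact le_sup_right
  have hxle : x ≤ a := inf_le_left.trans inf_le_left
  refine ⟨x, b ⊓ (x ⊔ p), hxa, isAtom_inf_sup hxa hp hpx (fun h => ha (h ▸ hxle)) hxb, hxle,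
    inf_le_left, ?_⟩
  rw [sup_inf_sup_of_le hpx]
  exact le_sup_right

/-- A modular ortholattice with a finite maximal chain is atomic. -/
theorem IsFiniteDimensional.isAtomic {L : Type*} [ModularOrtholattice L]
    (h : IsFiniteDimensional L) : IsAtomic L := by
  obtain ⟨c, hfin, hc⟩ := h
  have mem : ∀ z : L, (∀ x ∈ c, z ≤ x ∨ x ≤ z) → z ∈ c := fun z hz => by
    have := hc.2 (hc.1.insert fun x hx _ => hz x hx) (Set.subset_insert z c)
    rw [this]; exact Set.mem_insert z c
  refine ⟨fun a => or_iff_not_imp_left.2 fun ha => ?_⟩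
  -- With `x` the least chain member not disjoint from `a` and `y` its predecessor, `ay = 0` and `y
  -- ⋖ x`, so `ax` is an atom.
  obtain ⟨x, hx⟩ := (hfin.subset (Set.sep_subset c fun x => a ⊓ x ≠ ⊥)).exists_minimal
    ⟨⊤, mem ⊤ fun x _ => Or.inr le_top, by simpa using ha⟩
  have hx0 : x ≠ ⊥ := fun h => hx.1.2 (by simp [h])
  obtain ⟨y, hy⟩ := (hfin.subset (Set.sep_subset c fun y => y < x)).exists_maximal
    ⟨⊥, mem ⊥ fun x _ => Or.inl bot_le, bot_lt_iff_ne_bot.2 hx0⟩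
  have hay : a ⊓ y = ⊥ := by
    by_contra hne
    exact absurd (hx.2 ⟨hy.1.1, hne⟩ hy.1.2.le) hy.1.2.not_ge
  have hcov : y ⋖ x := by
    refine ⟨hy.1.2, fun z hyz hzx => ?_⟩
    have hz : z ∈ c := mem z fun w hw => by
      by_cases hwx : w < x
      · rcases hc.1.total hw hy.1.1 with h | h
        · exact Or.inr (h.trans hyz.le)
        · exact Or.inr ((hy.2 ⟨hw, hwx⟩ h).trans hyz.le)
      · rcases hc.1.total hw hx.1.1 with h | h
        · exact Or.inl (hzx.le.trans (h.eq_of_not_lt hwx).ge)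
        · exact Or.inl (hzx.le.trans h)
    exact absurd (hy.2 ⟨hz, hzx⟩ hyz.le) hyz.not_ge
  refine ⟨a ⊓ x, ?_, inf_le_left⟩
  have hd : y ⊓ (a ⊓ x) = ⊥ := by
    rw [← le_bot_iff, ← hay]
    exact le_inf (inf_le_right.trans inf_le_left) inf_le_left
  refine isAtom_of_sup_covBy (b := y) ?_ hd
  have hlt : y < y ⊔ a ⊓ x := left_lt_sup.2 fun h => hx.1.2 (by rwa [inf_eq_right.2 h] at hd)
  rcases hcov.eq_or_eq hlt.le (sup_le hy.1.2.le inf_le_right) with h | h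
  · exact absurd h hlt.ne'
  · rwa [h]

/-! ### Terms -/

theorem OrthoTerm.eval_map {L M : Type*} [Ortholattice L] [Ortholattice M] (f : L → M)
    (hbot : f ⊥ = ⊥) (htop : f ⊤ = ⊤) (hsup : ∀ a b, f (a ⊔ b) = f a ⊔ f b)
    (hinf : ∀ a b, f (a ⊓ b) = f a ⊓ f b) (hcompl : ∀ a, f aᶜ = (f a)ᶜ) (v : ℕ → L)
    (t : OrthoTerm) : f (t.eval v) = t.eval (f ∘ v) := by
  induction t with
  | var n => rfl
  | zero => exact hbot
  | one => exact htop
  | join s t hs ht => simp only [eval, hsup, hs, ht]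
  | meet s t hs ht => simp only [eval, hinf, hs, ht]
  | compl s hs => simp only [eval, hcompl, hs]

/-- The term `s(st)'`, which vanishes if and only if `s ≤ t`. -/
def OrthoTerm.diff (s t : OrthoTerm) : OrthoTerm := .meet s (.compl (.meet s t))

theorem OrthoTerm.eval_diff_eq_bot {L : Type*} [ModularOrtholattice L] {v : ℕ → L}
    {s t : OrthoTerm} : (s.diff t).eval v = ⊥ ↔ s.eval v ≤ t.eval v := by
  refine ⟨le_of_inf_compl_inf_eq_bot, fun h => ?_⟩
  simp only [diff, eval, inf_eq_left.2 h, Ortholattice.inf_compl_self]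

/-- A numbering of terms. -/
def OrthoTerm.code : OrthoTerm → ℕ
  | .var n => Nat.pair 0 n
  | .zero => Nat.pair 1 0
  | .one => Nat.pair 2 0
  | .join s t => Nat.pair 3 (Nat.pair s.code t.code)
  | .meet s t => Nat.pair 4 (Nat.pair s.code t.code)
  | .compl s => Nat.pair 5 s.code

theorem OrthoTerm.code_injective : Function.Injective OrthoTerm.code := by
  intro s
  induction s with
  | var n => intro t; cases t <;> simp [code, Nat.pair_eq_pair]
  | zero => intro t; cases t <;> simp [code, Nat.pair_eq_pair]
  | one => intro t; cases t <;> simp [code, Nat.pair_eq_pair]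
  | join a b ha hb =>
    intro t; cases t <;> simp [code, Nat.pair_eq_pair]
    exact fun h₁ h₂ => ⟨ha h₁, hb h₂⟩
  | meet a b ha hb =>
    intro t; cases t <;> simp [code, Nat.pair_eq_pair]
    exact fun h₁ h₂ => ⟨ha h₁, hb h₂⟩
  | compl a ha =>
    intro t; cases t <;> simp [code, Nat.pair_eq_pair]
    exact fun h => ha h

/-- Countability of the terms is what makes an ultraproduct over `ℕ` sufficiently saturated later
on. -/
instance : Countable OrthoTerm := OrthoTerm.code_injective.countable

/-! ### Intervals and products -/

/-- The interval below `u`, with the relative orthocomplement `x ↦ u xᶜ`. -/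
instance iicModularOrtholattice {L : Type*} [ModularOrtholattice L] (u : L) :
    ModularOrtholattice (Set.Iic u) where
  compl x := ⟨u ⊓ x.1ᶜ, inf_le_left⟩
  sup_compl_self x := Subtype.ext (sup_inf_compl_of_le x.2)
  inf_compl_self x := Subtype.ext <| by
    change x.1 ⊓ (u ⊓ x.1ᶜ) = ⊥
    rw [inf_left_comm, Ortholattice.inf_compl_self, inf_bot_eq]
  compl_compl_self x := Subtype.ext (inf_compl_inf_compl_of_le x.2)
  compl_antitone _ _ h := inf_le_inf_left u (compl_le_compl' h)
  toIsModularLattice := inferInstance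

instance piModularOrtholattice {ι : Type*} (M : ι → Type*) [∀ i, ModularOrtholattice (M i)] :
    ModularOrtholattice (∀ i, M i) where
  compl x i := (x i)ᶜ
  sup_compl_self x := funext fun i => Ortholattice.sup_compl_self (x i)
  inf_compl_self x := funext fun i => Ortholattice.inf_compl_self (x i)
  compl_compl_self x := funext fun i => Ortholattice.compl_compl_self (x i)
  compl_antitone _ _ h i := compl_le_compl' (h i)
  sup_inf_le_assoc_of_le y _ h i := IsModularLattice.sup_inf_le_assoc_of_le (y i) (h i)

theorem OrthoTerm.eval_pi {ι : Type*} {M : ι → Type*} [∀ i, ModularOrtholattice (M i)]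
    (v : ℕ → ∀ i, M i) (t : OrthoTerm) (i : ι) : t.eval v i = t.eval (fun n => v n i) :=
  OrthoTerm.eval_map (fun x : ∀ i, M i => x i) rfl rfl (fun _ _ => rfl) (fun _ _ => rfl)
    (fun _ => rfl) v t

/-! ### Ultraproducts -/

section Ultraproduct

variable {ι : Type*} (U : Ultrafilter ι) (M : ι → Type*)

/-- Equality almost everywhere. -/
def ultraSetoid : Setoid (∀ i, M i) where
  r f g := ∀ᶠ i in U, f i = g i
  iseqv := ⟨fun _ => .of_forall fun _ => rfl, fun h => h.mono fun _ h => h.symm,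
    fun h h' => by filter_upwards [h, h'] with i h h'; exact h.trans h'⟩

/-- The ultraproduct of a family. -/
def Ultraproduct := Quotient (ultraSetoid U M)

namespace Ultraproduct

variable {M}

/-- The class of a family. -/
def mk (f : ∀ i, M i) : Ultraproduct U M := Quotient.mk (ultraSetoid U M) f

variable {U}

theorem mk_eq {f g : ∀ i, M i} : mk U f = mk U g ↔ ∀ᶠ i in U, f i = g i := Quotient.eq

theorem exists_mk (x : Ultraproduct U M) : ∃ f, mk U f = x := Quotient.exists_rep x

variable [∀ i, ModularOrtholattice (M i)]

instance : LE (Ultraproduct U M) where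
  le := Quotient.lift₂ (fun f g => ∀ᶠ i in U, f i ≤ g i) fun f g f' g' hf hg =>
    propext <| Filter.eventually_congr <| by
      filter_upwards [hf, hg] with i hf hg
      rw [hf, hg]

theorem mk_le {f g : ∀ i, M i} : mk U f ≤ mk U g ↔ ∀ᶠ i in U, f i ≤ g i := Iff.rfl

instance : Max (Ultraproduct U M) where
  max := Quotient.map₂ (fun f g i => f i ⊔ g i) fun f f' hf g g' hg => by
    filter_upwards [hf, hg] with i hf hg
    rw [hf, hg]

instance : Min (Ultraproduct U M) where
  min := Quotient.map₂ (fun f g i => f i ⊓ g i) fun f f' hf g g' hg => by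
    filter_upwards [hf, hg] with i hf hg
    rw [hf, hg]

instance : ModularOrtholattice (Ultraproduct U M) where
  le_refl := Quotient.ind fun f => .of_forall fun i => le_rfl
  le_trans x y z := by
    induction x, y, z using Quotient.inductionOn₃ with | _ f g h
    exact fun h₁ h₂ => by filter_upwards [h₁, h₂] with i h₁ h₂; exact h₁.trans h₂
  le_antisymm x y := by
    induction x, y using Quotient.inductionOn₂ with | _ f g
    exact fun h₁ h₂ => mk_eq.2 (by filter_upwards [h₁, h₂] with i h₁ h₂; exact le_antisymm h₁ h₂)
  sup := max
  le_sup_left x y := by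
    induction x, y using Quotient.inductionOn₂ with | _ f g
    exact .of_forall fun i => le_sup_left
  le_sup_right x y := by
    induction x, y using Quotient.inductionOn₂ with | _ f g
    exact .of_forall fun i => le_sup_right
  sup_le x y z := by
    induction x, y, z using Quotient.inductionOn₃ with | _ f g h
    exact fun h₁ h₂ => by filter_upwards [h₁, h₂] with i h₁ h₂; exact sup_le h₁ h₂
  inf := min
  inf_le_left x y := by
    induction x, y using Quotient.inductionOn₂ with | _ f g
    exact .of_forall fun i => inf_le_left
  inf_le_right x y := by
    induction x, y using Quotient.inductionOn₂ with | _ f g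
    exact .of_forall fun i => inf_le_right
  le_inf x y z := by
    induction x, y, z using Quotient.inductionOn₃ with | _ f g h
    exact fun h₁ h₂ => by filter_upwards [h₁, h₂] with i h₁ h₂; exact le_inf h₁ h₂
  top := mk U fun _ => ⊤
  le_top := Quotient.ind fun f => .of_forall fun i => le_top
  bot := mk U fun _ => ⊥
  bot_le := Quotient.ind fun f => .of_forall fun i => bot_le
  compl := Quotient.map (fun f i => (f i)ᶜ) fun f g h => h.mono fun i h => by simp only [h]
  sup_compl_self := Quotient.ind fun f =>
    mk_eq.2 (.of_forall fun i => Ortholattice.sup_compl_self _)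
  inf_compl_self := Quotient.ind fun f =>
    mk_eq.2 (.of_forall fun i => Ortholattice.inf_compl_self _)
  compl_compl_self := Quotient.ind fun f =>
    mk_eq.2 (.of_forall fun i => Ortholattice.compl_compl_self _)
  compl_antitone x y := by
    induction x, y using Quotient.inductionOn₂ with | _ f g
    exact fun h => Filter.Eventually.mono h fun i h => compl_le_compl' h
  sup_inf_le_assoc_of_le {x} y {z} := by
    induction x, y, z using Quotient.inductionOn₃ with | _ f g h
    exact fun h => Filter.Eventually.mono h fun i h =>
      IsModularLattice.sup_inf_le_assoc_of_le _ h

theorem mk_compl (f : ∀ i, M i) : (mk U f)ᶜ = mk U fᶜ := rfl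

theorem eval_mk (v : ℕ → ∀ i, M i) (t : OrthoTerm) :
    t.eval (fun n => mk U (v n)) = mk U (fun i => t.eval fun n => v n i) := by
  rw [← funext (OrthoTerm.eval_pi v t)]
  exact (OrthoTerm.eval_map (mk U) rfl rfl (fun _ _ => rfl) (fun _ _ => rfl) (fun _ => rfl) v t).symm

/-- An instance of Łoś's theorem: being an atom is a first-order property. -/
theorem isAtom_mk {f : ∀ i, M i} : IsAtom (mk U f) ↔ ∀ᶠ i in U, IsAtom (f i) := by
  classical
  constructor
  · intro h
    have h0 : ∀ᶠ i in U, ¬ f i = ⊥ := Ultrafilter.eventually_not.2 fun h' => h.1 (mk_eq.2 h')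
    by_contra hne
    rw [← Ultrafilter.eventually_not] at hne
    have key : ∀ i, ∃ g : M i, f i ≠ ⊥ → ¬ IsAtom (f i) → g ≠ ⊥ ∧ g < f i := fun i => by
      by_cases h1 : f i = ⊥
      · exact ⟨⊥, fun h => absurd h1 h⟩
      · by_cases h2 : IsAtom (f i)
        · exact ⟨⊥, fun _ h => absurd h2 h⟩
        · simp only [IsAtom, not_and, not_forall] at h2
          obtain ⟨g, hg, hg'⟩ := h2 h1
          exact ⟨g, fun _ _ => ⟨hg', hg⟩⟩
    choose g hg using key
    have h1 : ∀ᶠ i in U, g i ≠ ⊥ ∧ g i < f i := by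
      filter_upwards [h0, hne] with i h0 h1 using hg i h0 h1
    rcases h.le_iff.1 (mk_le.2 (h1.mono fun i h => h.2.le)) with h2 | h2
    · obtain ⟨i, hi, hi'⟩ := (h1.and (mk_eq.1 h2)).exists
      exact hi.1 hi'
    · obtain ⟨i, hi, hi'⟩ := (h1.and (mk_eq.1 h2)).exists
      exact hi.2.ne hi'
  · intro h
    refine ⟨fun h0 => ?_, fun x hx => ?_⟩
    · obtain ⟨i, hi, hi'⟩ := (h.and (mk_eq.1 h0)).exists
      exact hi.1 hi'
    · obtain ⟨g, rfl⟩ := exists_mk x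
      have h1 : ∀ᶠ i in U, ¬ f i ≤ g i := Ultrafilter.eventually_not.2 fun h' => hx.not_ge h'
      have h2 : ∀ᶠ i in U, g i ≤ f i := hx.le
      refine mk_eq.2 ?_
      filter_upwards [h, h1, h2] with i h h1 h2
      exact h.2 _ (lt_of_le_not_ge h2 h1)

instance [∀ i, IsAtomic (M i)] : IsAtomic (Ultraproduct U M) := by
  refine ⟨fun x => or_iff_not_imp_left.2 fun hx => ?_⟩
  obtain ⟨f, rfl⟩ := exists_mk x
  have h0 : ∀ᶠ i in U, ¬ f i = ⊥ := Ultrafilter.eventually_not.2 fun h' => hx (mk_eq.2 h')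
  have key : ∀ i, ∃ g : M i, f i ≠ ⊥ → IsAtom g ∧ g ≤ f i := fun i => by
    rcases eq_bot_or_exists_atom_le (f i) with h | ⟨g, h⟩
    · exact ⟨⊥, fun h' => absurd h h'⟩
    · exact ⟨g, fun _ => h⟩
  choose g hg using key
  exact ⟨mk U g, isAtom_mk.2 (h0.mono fun i h => (hg i h).1),
    mk_le.2 (h0.mono fun i h => (hg i h).2)⟩

end Ultraproduct

end Ultraproduct

end MOL

namespace MOL

/-! ### Identities in atomic modular ortholattices -/

section AtomicIdentities

variable {N : Type u} [ModularOrtholattice N]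

/-- A further atom either leaves the join unchanged or gives a cover, which lengthens the chain by
one. Working in `N` rather than in intervals lets the upper bound vary during the induction. -/
theorem exists_finite_maxChain_sup_atoms (F : Finset N) (hF : ∀ p ∈ F, IsAtom p) :
    ∃ c : Set N, c.Finite ∧ IsChain (· ≤ ·) c ∧ (∀ x ∈ c, x ≤ F.sup id) ∧
      ∀ y ≤ F.sup id, (∀ x ∈ c, y ≤ x ∨ x ≤ y) → y ∈ c := by
  classical
  induction F using Finset.induction_on with
  | empty =>
    refine ⟨{⊥}, Set.finite_singleton _, Set.pairwise_singleton _ _, by simp, by simp⟩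
  | insert p F _ ih =>
    obtain ⟨c, hfin, hc, hle, hmax⟩ := ih fun q hq => hF q (Finset.mem_insert_of_mem hq)
    have hp : IsAtom p := hF p (Finset.mem_insert_self p F)
    rw [Finset.sup_insert, id, sup_comm]
    set a := F.sup id
    by_cases hpa : p ≤ a
    · rw [sup_eq_left.2 hpa]
      exact ⟨c, hfin, hc, hle, hmax⟩
    have hac : a ∈ c := hmax a le_rfl fun x hx => Or.inr (hle x hx)
    refine ⟨insert (a ⊔ p) c, hfin.insert _, hc.insert fun x hx _ =>
      Or.inr ((hle x hx).trans le_sup_left), ?_, ?_⟩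
    · rintro x (rfl | hx)
      · exact le_rfl
      · exact (hle x hx).trans le_sup_left
    · intro y hy hcomp
      rcases hcomp a (Or.inr hac) with h | h
      · exact Or.inr (hmax y h fun x hx => hcomp x (Or.inr hx))
      · rcases (covBy_sup_of_isAtom hp hpa).eq_or_eq h hy with h | h
        · exact Or.inr (h ▸ hac)
        · exact Or.inl h

theorem isFiniteDimensional_Iic_sup_atoms (F : Finset N) (hF : ∀ p ∈ F, IsAtom p) :
    IsFiniteDimensional (Set.Iic (F.sup id)) := by
  obtain ⟨c, hfin, hc, hle, hmax⟩ := exists_finite_maxChain_sup_atoms F hF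
  refine ⟨{x | x.1 ∈ c}, hfin.preimage Subtype.val_injective.injOn, ?_, ?_⟩
  · intro x hx y hy hne
    exact hc hx hy fun h => hne (Subtype.ext h)
  · intro d hd hcd
    refine hcd.antisymm fun y hy => hmax y.1 y.2 fun x hx => ?_
    exact hd.total hy (hcd (show (⟨x, hle x hx⟩ : Set.Iic (F.sup id)) ∈ _ from hx))

/-- A property holds for all elements above some finite join of atoms. -/
def HoldsAboveAtoms (φ : N → Prop) : Prop :=
  ∃ F : Finset N, (∀ p ∈ F, IsAtom p) ∧ ∀ u, F.sup id ≤ u → φ u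

theorem HoldsAboveAtoms.and {φ ψ : N → Prop} (hφ : HoldsAboveAtoms φ) (hψ : HoldsAboveAtoms ψ) :
    HoldsAboveAtoms fun u => φ u ∧ ψ u := by
  classical
  obtain ⟨F, hF, hφ⟩ := hφ
  obtain ⟨G, hG, hψ⟩ := hψ
  refine ⟨F ∪ G, fun p hp => (Finset.mem_union.1 hp).elim (hF p) (hG p), fun u hu => ?_⟩
  rw [Finset.sup_union] at hu
  exact ⟨hφ u (le_sup_left.trans hu), hψ u (le_sup_right.trans hu)⟩

theorem HoldsAboveAtoms.mono {φ ψ : N → Prop} (hφ : HoldsAboveAtoms φ) (h : ∀ u, φ u → ψ u) :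
    HoldsAboveAtoms ψ := by
  obtain ⟨F, hF, hφ⟩ := hφ
  exact ⟨F, hF, fun u hu => h u (hφ u hu)⟩

theorem holdsAboveAtoms_le {p : N} (hp : IsAtom p) : HoldsAboveAtoms fun u => p ≤ u :=
  ⟨{p}, by simpa using hp, fun u hu => by simpa using hu⟩

theorem holdsAboveAtoms_le_sup {a b p : N} {f g : N → N} (hp : IsAtom p) (h : p ≤ a ⊔ b)
    (hf : ∀ q, IsAtom q → q ≤ a → HoldsAboveAtoms fun u => q ≤ f u)
    (hg : ∀ q, IsAtom q → q ≤ b → HoldsAboveAtoms fun u => q ≤ g u) :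
    HoldsAboveAtoms fun u => p ≤ f u ⊔ g u := by
  by_cases ha : p ≤ a
  · exact (hf p hp ha).mono fun u h => h.trans le_sup_left
  by_cases hb : p ≤ b
  · exact (hg p hp hb).mono fun u h => h.trans le_sup_right
  obtain ⟨q, r, hq, hr, hqa, hrb, hpqr⟩ := exists_atoms_of_le_sup hp h ha hb
  exact ((hf q hq hqa).and (hg r hr hrb)).mono fun u h => hpqr.trans (sup_le_sup h.1 h.2)

/-- The assignment that cuts all values down to the interval below `u`. -/
def truncate (v : ℕ → N) (u : N) (n : ℕ) : Set.Iic u := ⟨u ⊓ v n, inf_le_left⟩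

/-- Truncation does not commute with terms, but atoms below values persist. Complements are carried
along so that the induction passes through `compl`; De Morgan's laws reduce their cases to joins and
meets, and only joins require new atoms. -/
theorem holdsAboveAtoms_le_eval (v : ℕ → N) (t : OrthoTerm) :
    (∀ p, IsAtom p → p ≤ t.eval v →
      HoldsAboveAtoms fun u => p ≤ (t.eval (truncate v u)).1) ∧
    (∀ p, IsAtom p → p ≤ (t.eval v)ᶜ →
      HoldsAboveAtoms fun u => p ≤ ((t.eval (truncate v u))ᶜ : Set.Iic u).1) := by
  induction t with
  | var n =>
    refine ⟨fun p hp h => (holdsAboveAtoms_le hp).mono fun u hu => le_inf hu h,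
      fun p hp h => (holdsAboveAtoms_le hp).mono fun u hu => le_inf hu ?_⟩
    exact h.trans (compl_le_compl' inf_le_right)
  | zero =>
    refine ⟨fun p hp h => absurd (le_bot_iff.1 h) hp.1,
      fun p hp h => (holdsAboveAtoms_le hp).mono fun u hu => ?_⟩
    rw [OrthoTerm.eval, compl_bot_eq]
    exact hu
  | one =>
    refine ⟨fun p hp _ => (holdsAboveAtoms_le hp).mono fun u hu => hu, fun p hp h => ?_⟩
    rw [OrthoTerm.eval, compl_top_eq] at h
    exact absurd (le_bot_iff.1 h) hp.1
  | join s t hs ht =>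
    refine ⟨fun p hp h => holdsAboveAtoms_le_sup hp h hs.1 ht.1, fun p hp h => ?_⟩
    simp only [OrthoTerm.eval, compl_sup_eq] at h ⊢
    exact ((hs.2 p hp (h.trans inf_le_left)).and (ht.2 p hp (h.trans inf_le_right))).mono
      fun u h => le_inf h.1 h.2
  | meet s t hs ht =>
    refine ⟨fun p hp h => ((hs.1 p hp (h.trans inf_le_left)).and
      (ht.1 p hp (h.trans inf_le_right))).mono fun u h => le_inf h.1 h.2, fun p hp h => ?_⟩
    simp only [OrthoTerm.eval, compl_inf_eq] at h ⊢
    exact holdsAboveAtoms_le_sup hp h hs.2 ht.2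
  | compl s hs =>
    simp only [OrthoTerm.eval, Ortholattice.compl_compl_self]
    exact ⟨hs.2, hs.1⟩

theorem eval_eq_bot_of_isAtomic [IsAtomic N] {t : OrthoTerm}
    (ht : ∀ (M : Type u) [ModularOrtholattice M], IsFiniteDimensional M →
      ∀ v : ℕ → M, t.eval v = ⊥) (v : ℕ → N) : t.eval v = ⊥ := by
  refine (eq_bot_or_exists_atom_le (t.eval v)).resolve_right ?_
  rintro ⟨p, hp, hle⟩
  obtain ⟨F, hF, h⟩ := (holdsAboveAtoms_le_eval v t).1 p hp hle
  have h1 : p ≤ (t.eval (truncate v (F.sup id))).1 := h _ le_rfl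
  rw [ht _ (isFiniteDimensional_Iic_sup_atoms F hF)] at h1
  exact hp.1 (le_bot_iff.1 h1)

end AtomicIdentities

theorem HasAtomicExtension.isProatomic {L : Type u} [ModularOrtholattice L]
    (h : HasAtomicExtension L) : IsProatomic L := by
  obtain ⟨N, _, f, _, hinj, hcompl⟩ := h
  have key : ∀ s t : OrthoTerm, (∀ (M : Type u) [ModularOrtholattice M],
      IsFiniteDimensional M → Satisfies M s t) → ∀ v : ℕ → N, s.eval v ≤ t.eval v :=
    fun s t hst v => OrthoTerm.eval_diff_eq_bot.1 <| eval_eq_bot_of_isAtomic (fun M _ hM w =>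
      OrthoTerm.eval_diff_eq_bot.2 (hst M hM w).le) v
  intro s t hst v
  apply hinj
  rw [OrthoTerm.eval_map f (map_bot f) (map_top f) (map_sup f) (map_inf f) hcompl,
    OrthoTerm.eval_map f (map_bot f) (map_top f) (map_sup f) (map_inf f) hcompl]
  exact le_antisymm (key s t hst _) (key t s (fun M _ hM w => (hst M hM w).symm) _)

end MOL

namespace MOL

/-! ### The modular lattice of subspaces -/

section Subspaces

variable {P : Type u} [ProjectiveSpace P]

open ProjectiveSpace ProjSubspace

theorem collinear_trans {p q r s : P} (hr : Collinear p q r) (hs : Collinear p q s)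
    (hne : r ≠ s) : Collinear p r s := by
  by_contra h
  -- The triangle axiom with vertices `r, p, s` and `q` as the chosen point on both sides would put
  -- `q, q, u` on a line.
  obtain ⟨u, ⟨-, hu⟩, -⟩ := triangle (collinear_swap (collinear_rotate hr)) hs hne
    fun h' => h (collinear_swap h')
  exact ne_of_collinear hu rfl

/-- The points on lines that join a point of `X` and a point of `Y`. -/
def joinSet (X Y : ProjSubspace P) : Set P :=
  {r | r ∈ X ∨ r ∈ Y ∨ ∃ p ∈ X, ∃ q ∈ Y, Collinear p q r}

theorem joinSet_comm (X Y : ProjSubspace P) : joinSet X Y = joinSet Y X := by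
  have : ∀ X Y : ProjSubspace P, joinSet X Y ⊆ joinSet Y X := by
    rintro X Y r (h | h | ⟨p, hp, q, hq, h⟩)
    · exact Or.inr (Or.inl h)
    · exact Or.inl h
    · exact Or.inr (Or.inr ⟨q, hq, p, hp, collinear_swap h⟩)
  exact (this X Y).antisymm (this Y X)

theorem mem_joinSet_of_collinear_left {X Y : ProjSubspace P} {r x z : P} (hr : r ∈ joinSet X Y)
    (hx : x ∈ X) (h : Collinear r x z) : z ∈ joinSet X Y := by
  rcases hr with hr | hr | ⟨p, hp, q, hq, hpq⟩
  · exact Or.inl (X.closed hr hx h)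
  · exact Or.inr (Or.inr ⟨x, hx, r, hr, collinear_swap h⟩)
  have hpr : Collinear p r q := collinear_swap (collinear_rotate (collinear_rotate hpq))
  have key : Collinear p r z → z ∈ joinSet X Y := fun hz => by
    by_cases hqz : q = z
    · exact Or.inr (Or.inl (hqz ▸ hq))
    · exact Or.inr (Or.inr ⟨p, hp, q, hq, collinear_trans hpr hz hqz⟩)
  by_cases hxp : x = p
  · subst hxp
    exact key (collinear_swap h)
  by_cases hxr : Collinear x r p
  · by_cases hzp : p = z
    · exact Or.inl (hzp ▸ hp)
    · exact key (collinear_swap (collinear_trans (collinear_swap hxr) h hzp))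
  -- In the triangle `x, r, p` the line `zq` meets the side `xp` in a point `u` of `X`, so `z` lies
  -- on the line `uq`.
  · obtain ⟨u, ⟨hu, hzu⟩, -⟩ := triangle (collinear_rotate h) (collinear_rotate hpr) hxp hxr
    exact Or.inr (Or.inr ⟨u, X.closed hx hp hu, q, hq,
      collinear_swap (collinear_rotate hzu)⟩)

theorem mem_joinSet_of_collinear_right {X Y : ProjSubspace P} {r y z : P} (hr : r ∈ joinSet X Y)
    (hy : y ∈ Y) (h : Collinear r y z) : z ∈ joinSet X Y := by
  rw [joinSet_comm] at hr ⊢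
  exact mem_joinSet_of_collinear_left hr hy h

theorem mem_joinSet_of_collinear {X Y : ProjSubspace P} {r s z : P} (hr : r ∈ joinSet X Y)
    (hs : s ∈ joinSet X Y) (h : Collinear r s z) : z ∈ joinSet X Y := by
  rcases hs with hs | hs | ⟨p, hp, q, hq, hpq⟩
  · exact mem_joinSet_of_collinear_left hr hs h
  · exact mem_joinSet_of_collinear_right hr hs h
  by_cases hrp : r = p
  · subst hrp
    exact mem_joinSet_of_collinear_left (Or.inr (Or.inr ⟨r, hp, q, hq, hpq⟩)) hp
      (collinear_swap h)
  by_cases hrsp : Collinear r s p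
  · by_cases hzp : p = z
    · exact Or.inl (hzp ▸ hp)
    · exact mem_joinSet_of_collinear_left hr hp (collinear_trans hrsp h hzp)
  · obtain ⟨u, ⟨hu, hzu⟩, -⟩ := triangle
      (collinear_swap (collinear_rotate (collinear_rotate h)))
      (collinear_swap (collinear_rotate hpq)) hrp hrsp
    exact mem_joinSet_of_collinear_right (mem_joinSet_of_collinear_left hr hp hu) hq
      (collinear_swap (collinear_rotate hzu))

theorem mem_sup {X Y : ProjSubspace P} {r : P} :
    r ∈ X ⊔ Y ↔ r ∈ X ∨ r ∈ Y ∨ ∃ p ∈ X, ∃ q ∈ Y, Collinear p q r := by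
  constructor
  · have h : X ⊔ Y ≤ ⟨joinSet X Y, mem_joinSet_of_collinear⟩ :=
      sup_le (fun _ h => Or.inl h) (fun _ h => Or.inr (Or.inl h))
    exact fun hr => h hr
  · rintro (h | h | ⟨p, hp, q, hq, h⟩)
    · exact (le_sup_left : X ≤ X ⊔ Y) h
    · exact (le_sup_right : Y ≤ X ⊔ Y) h
    · exact (X ⊔ Y).closed ((le_sup_left : X ≤ X ⊔ Y) hp) ((le_sup_right : Y ≤ X ⊔ Y) hq) h

instance : IsModularLattice (ProjSubspace P) where
  sup_inf_le_assoc_of_le {X} Y {Z} hXZ r hr := by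
    obtain ⟨hr, hrZ⟩ := hr
    rcases mem_sup.1 hr with h | h | ⟨x, hx, y, hy, h⟩
    · exact mem_sup.2 (Or.inl h)
    · exact mem_sup.2 (Or.inr (Or.inl ⟨h, hrZ⟩))
    · exact mem_sup.2 (Or.inr (Or.inr ⟨x, hx, y, ⟨hy, Z.closed (hXZ hx) hrZ
        (collinear_swap (collinear_rotate (collinear_rotate h)))⟩, h⟩))

theorem point_le {p : P} {X : ProjSubspace P} : point p ≤ X ↔ p ∈ X :=
  ⟨fun h => h rfl, fun h q hq => (show q = p from hq) ▸ h⟩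

theorem isAtom_point (p : P) : IsAtom (point p) := by
  refine ⟨fun h => (show p ∈ (⊥ : ProjSubspace P) from h ▸ (rfl : p = p)), fun X hX => ?_⟩
  refine le_bot_iff.1 fun q hq => hX.not_ge ?_
  have hqp : q = p := hX.le hq
  exact point_le.2 (hqp ▸ hq)

end Subspaces

/-! ### Subspaces that split the space -/

namespace Orthogonality

section Splitting

variable {P : Type u} [ProjectiveSpace P] {o : Orthogonality P} {X Y Z : ProjSubspace P} {p q : P}

open ProjectiveSpace ProjSubspace

theorem le_orth_comm (h : X ≤ o.orth Y) : Y ≤ o.orth X :=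
  fun _ hp _ hq => o.symm (h hq _ hp)

theorem mem_orth_point : q ∈ o.orth (point p) ↔ o.Perp p q :=
  ⟨fun h => h p rfl, fun h r hr => (show r = p from hr) ▸ h⟩

theorem orth_antitone (h : X ≤ Y) : o.orth Y ≤ o.orth X :=
  fun _ hp q hq => hp q (h hq)

theorem le_orth_orth : X ≤ o.orth (o.orth X) := le_orth_comm le_rfl

theorem orth_sup : o.orth (X ⊔ Y) = o.orth X ⊓ o.orth Y :=
  le_antisymm (le_inf (orth_antitone le_sup_left) (orth_antitone le_sup_right))
    (le_orth_comm (sup_le (le_orth_comm inf_le_left) (le_orth_comm inf_le_right)))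

theorem inf_orth_self (ha : o.IsAnisotropic) (X : ProjSubspace P) : X ⊓ o.orth X = ⊥ :=
  le_bot_iff.1 fun p hp => ha p (hp.2 p hp.1)

/-- A subspace that together with its orthogonal subspace spans the whole space. -/
def Splits (o : Orthogonality P) (X : ProjSubspace P) : Prop := X ⊔ o.orth X = ⊤

/-- Modularity and `X ∩ X^⊥ = 0` leave no room between `Y` and `X^⊥`. -/
theorem eq_orth_of_sup_eq_top (ha : o.IsAnisotropic) (hle : Y ≤ o.orth X) (h : X ⊔ Y = ⊤) :
    Y = o.orth X := by
  refine hle.antisymm ?_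
  calc o.orth X = (Y ⊔ X) ⊓ o.orth X := by rw [sup_comm, h, top_inf_eq]
    _ = Y ⊔ X ⊓ o.orth X := sup_inf_assoc_of_le _ hle
    _ ≤ Y := by rw [inf_orth_self ha, sup_bot_eq]

theorem Splits.orth_orth (ha : o.IsAnisotropic) (h : o.Splits X) : o.orth (o.orth X) = X :=
  (eq_orth_of_sup_eq_top ha le_orth_orth (by rw [sup_comm]; exact h)).symm

theorem Splits.orth (ha : o.IsAnisotropic) (h : o.Splits X) : o.Splits (o.orth X) := by
  rw [Splits, h.orth_orth ha, sup_comm]; exact h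

theorem sup_orth_point_eq_top (hpol : o.IsPolarity) (h : ¬ o.Perp p q) :
    point q ⊔ o.orth (point p) = ⊤ :=
  (hpol.2 p).2 _ (right_lt_sup.2 fun h' => h (mem_orth_point.1 (point_le.1 h')))

theorem eq_sup_inf_orth_point (hpol : o.IsPolarity) (h : ¬ o.Perp p q) (hq : q ∈ X) :
    X = point q ⊔ X ⊓ o.orth (point p) := by
  rw [inf_comm, ← sup_inf_assoc_of_le _ (point_le.2 hq), sup_orth_point_eq_top hpol h, top_inf_eq]

/-- A Gram–Schmidt step: modulo `X`, the point `p` may be replaced by its component in `X^⊥`. -/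
theorem Splits.exists_orthogonal_point (h : o.Splits X) (hp : p ∉ X) :
    ∃ q ∈ o.orth X, X ⊔ point p = X ⊔ point q := by
  have hpt : p ∈ X ⊔ o.orth X := by rw [show X ⊔ o.orth X = ⊤ from h]; trivial
  rcases mem_sup.1 hpt with h | h | ⟨x, hx, q, hq, h⟩
  · exact absurd h hp
  · exact ⟨p, h, rfl⟩
  · refine ⟨q, hq, sup_eq_sup_of_exchange (isAtom_point q) (point_le.2 ?_)
      fun h => hp (point_le.1 h)⟩
    exact mem_sup.2 (Or.inr (Or.inr ⟨x, hx, q, rfl, h⟩))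

theorem Splits.sup_point (hpol : o.IsPolarity) (ha : o.IsAnisotropic) (h : o.Splits X) (p : P) :
    o.Splits (X ⊔ point p) := by
  by_cases hp : p ∈ X
  · rwa [sup_eq_left.2 (point_le.2 hp)]
  obtain ⟨q, hq, hpq⟩ := h.exists_orthogonal_point hp
  rw [Splits, hpq, orth_sup, sup_assoc, ← eq_sup_inf_orth_point hpol (ha q) hq]
  exact h

theorem orth_inf_orth_point (hpol : o.IsPolarity) (ha : o.IsAnisotropic) (h : o.Splits X)
    (p : P) : o.orth (X ⊓ o.orth (point p)) = o.orth X ⊔ point p := by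
  rw [← ((h.orth ha).sup_point hpol ha p).orth_orth ha, orth_sup, h.orth_orth ha]

theorem Splits.inf_orth_point (hpol : o.IsPolarity) (ha : o.IsAnisotropic) (h : o.Splits X)
    (p : P) : o.Splits (X ⊓ o.orth (point p)) := by
  have := ((h.orth ha).sup_point hpol ha p).orth ha
  rwa [orth_sup, h.orth_orth ha] at this

/-- Splitting subspaces such that their join and the join of their orthogonal subspaces split. -/
structure SplittingPair (o : Orthogonality P) (X Y : ProjSubspace P) : Prop where
  left : o.Splits X
  right : o.Splits Y
  sup : o.Splits (X ⊔ Y)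
  sup_orth : o.Splits (o.orth X ⊔ o.orth Y)

theorem SplittingPair.symm (h : o.SplittingPair X Y) : o.SplittingPair Y X :=
  ⟨h.right, h.left, by rw [sup_comm]; exact h.sup, by rw [sup_comm]; exact h.sup_orth⟩

theorem SplittingPair.orth (ha : o.IsAnisotropic) (h : o.SplittingPair X Y) :
    o.SplittingPair (o.orth X) (o.orth Y) :=
  ⟨h.left.orth ha, h.right.orth ha, h.sup_orth, by
    rw [h.left.orth_orth ha, h.right.orth_orth ha]; exact h.sup⟩

theorem SplittingPair.orth_sup_orth (ha : o.IsAnisotropic) (h : o.SplittingPair X Y) :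
    o.orth X ⊔ o.orth Y = o.orth (X ⊓ Y) := by
  rw [← h.sup_orth.orth_orth ha, orth_sup, h.left.orth_orth ha, h.right.orth_orth ha]

/-- After replacing `p` by a point `q` of `X`, the join `Z` satisfies `Z + q = X + Y`, so it is
everything or a hyperplane of `X + Y`. In the second case a point `y` is needed that is orthogonal
to `Z` but not to `X`. -/
theorem SplittingPair.inf_orth_point_sup (hpol : o.IsPolarity) (ha : o.IsAnisotropic)
    (h : o.SplittingPair X Y) (p : P) :
    X ⊓ o.orth (point p) ⊔ Y = X ⊔ Y ∨
      ∃ y, X ⊓ o.orth (point p) ⊔ Y = (X ⊔ Y) ⊓ o.orth (point y) := by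
  by_cases hp : p ∈ o.orth X
  · exact Or.inl (by rw [inf_eq_left.2 (le_orth_comm (point_le.2 hp))])
  obtain ⟨q, hq, hpq⟩ := (h.left.orth ha).exists_orthogonal_point hp
  have hXq : X ⊓ o.orth (point p) = o.orth (o.orth X ⊔ point q) := by
    rw [← hpq, orth_sup, h.left.orth_orth ha]
  have hXq' : X ⊓ o.orth (point p) = X ⊓ o.orth (point q) := by
    rw [hXq, orth_sup, h.left.orth_orth ha]
  rw [h.left.orth_orth ha] at hq
  have hqX : q ∉ o.orth X := fun h => ha q (h q hq)
  set Z := X ⊓ o.orth (point p) ⊔ Y with hZ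
  have hZq : Z ⊔ point q = X ⊔ Y := by
    rw [hZ, hXq', sup_right_comm, sup_comm (X ⊓ _), ← eq_sup_inf_orth_point hpol (ha q) hq]
  by_cases hqZ : q ∈ Z
  · exact Or.inl (by rw [← hZq, sup_eq_left.2 (point_le.2 hqZ)])
  right
  -- A point `z` of `X ∩ Y` not orthogonal to `q` would give `X = z + (X ∩ q^⊥) ≤ Z`, contradicting
  -- `q ∉ Z`.
  have hqXY : q ∈ o.orth X ⊔ o.orth Y := by
    rw [h.orth_sup_orth ha]
    intro z hz
    by_contra hzq
    refine hqZ ?_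
    have hX := eq_sup_inf_orth_point hpol (fun h => hzq (o.symm h)) hz.1
    rw [← hXq'] at hX
    have hle : X ≤ Z := hX.le.trans
      (sup_le ((point_le.2 hz.2).trans le_sup_right) le_sup_left)
    exact hle hq
  -- The point `y` is the component of `q` in `Y^⊥`.
  obtain ⟨y, hyY, hyq, hyX⟩ : ∃ y ∈ o.orth Y, y ∈ o.orth X ⊔ point q ∧ y ∉ o.orth X := by
    rcases mem_sup.1 hqXY with h | h | ⟨x, hx, y, hy, hc⟩
    · exact absurd h hqX
    · exact ⟨q, h, (le_sup_right : point q ≤ _) rfl, hqX⟩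
    · exact ⟨y, hy, mem_sup.2 (Or.inr (Or.inr ⟨x, hx, q, rfl,
        collinear_swap (collinear_rotate (collinear_rotate hc))⟩)),
        fun hyX => hqX ((o.orth X).closed hx hyX hc)⟩
  refine ⟨y, ?_⟩
  have hZle : Z ≤ (X ⊔ Y) ⊓ o.orth (point y) := by
    refine le_inf (sup_le_sup_right inf_le_left _) (sup_le ?_ (le_orth_comm (point_le.2 hyY)))
    rw [hXq]
    exact orth_antitone (point_le.2 hyq)
  rcases (covBy_sup_of_isAtom (isAtom_point q) (fun h => hqZ (point_le.1 h))).eq_or_eq hZle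
    (inf_le_left.trans hZq.ge) with h1 | h1
  · exact h1.symm
  · rw [hZq, inf_eq_left] at h1
    exact absurd (point_le.1 (le_orth_comm (le_sup_left.trans h1))) hyX

theorem SplittingPair.inf_orth_point (hpol : o.IsPolarity) (ha : o.IsAnisotropic)
    (h : o.SplittingPair X Y) (p : P) : o.SplittingPair (X ⊓ o.orth (point p)) Y := by
  refine ⟨h.left.inf_orth_point hpol ha p, h.right, ?_, ?_⟩
  · rcases h.inf_orth_point_sup hpol ha p with h' | ⟨y, h'⟩
    · rw [h']; exact h.sup
    · rw [h']; exact h.sup.inf_orth_point hpol ha y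
  · rw [orth_inf_orth_point hpol ha h.left, sup_right_comm]
    exact h.sup_orth.sup_point hpol ha p

/-- The dual of `SplittingPair.inf_orth_point`, obtained by passing to orthogonal subspaces. -/
theorem SplittingPair.sup_point (hpol : o.IsPolarity) (ha : o.IsAnisotropic)
    (h : o.SplittingPair X Y) (p : P) : o.SplittingPair (X ⊔ point p) Y := by
  have h1 := ((h.orth ha).inf_orth_point hpol ha p).orth ha
  rwa [orth_inf_orth_point hpol ha (h.left.orth ha), h.left.orth_orth ha,
    h.right.orth_orth ha] at h1

end Splitting

/-! ### Finite variants of a family of splitting subspaces -/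

section FiniteVariant

variable {P : Type u} [ProjectiveSpace P] {o : Orthogonality P} {B : Set (ProjSubspace P)}
  {X Y : ProjSubspace P}

open ProjSubspace

/-- A family of splitting subspaces that contains `⊥` and is closed under joins and
orthogonal subspaces. -/
structure IsOrthoFamily (o : Orthogonality P) (B : Set (ProjSubspace P)) : Prop where
  splits : ∀ X ∈ B, o.Splits X
  bot_mem : ⊥ ∈ B
  sup_mem : ∀ X ∈ B, ∀ Y ∈ B, X ⊔ Y ∈ B
  orth_mem : ∀ X ∈ B, o.orth X ∈ B

/-- The subspaces that arise from the members of `B` by finitely many joins with points and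
meets with orthogonal subspaces of points. -/
inductive FiniteVariant (o : Orthogonality P) (B : Set (ProjSubspace P)) : ProjSubspace P → Prop
  | base (X : ProjSubspace P) : X ∈ B → FiniteVariant o B X
  | sup_point (X : ProjSubspace P) (p : P) : FiniteVariant o B X →
      FiniteVariant o B (X ⊔ point p)
  | inf_orth_point (X : ProjSubspace P) (p : P) : FiniteVariant o B X →
      FiniteVariant o B (X ⊓ o.orth (point p))

theorem FiniteVariant.splits (hpol : o.IsPolarity) (ha : o.IsAnisotropic)
    (hB : o.IsOrthoFamily B) (hX : o.FiniteVariant B X) : o.Splits X := by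
  induction hX with
  | base X hX => exact hB.splits X hX
  | sup_point X p _ h => exact h.sup_point hpol ha p
  | inf_orth_point X p _ h => exact h.inf_orth_point hpol ha p

theorem FiniteVariant.orth (hpol : o.IsPolarity) (ha : o.IsAnisotropic)
    (hB : o.IsOrthoFamily B) (hX : o.FiniteVariant B X) : o.FiniteVariant B (o.orth X) := by
  induction hX with
  | base X hX => exact .base _ (hB.orth_mem X hX)
  | sup_point X p _ h => rw [orth_sup]; exact .inf_orth_point _ p h
  | inf_orth_point X p hX h =>
    rw [orth_inf_orth_point hpol ha (hX.splits hpol ha hB)]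
    exact .sup_point _ p h

/-- Both conclusions are proved together, since a meet with `p^⊥` can be handled only for a
splitting pair. -/
theorem FiniteVariant.sup_of_splittingPair (hpol : o.IsPolarity) (ha : o.IsAnisotropic)
    (hX : o.FiniteVariant B X) (h : ∀ Z ∈ B, o.SplittingPair Z Y ∧ o.FiniteVariant B (Z ⊔ Y)) :
    o.SplittingPair X Y ∧ o.FiniteVariant B (X ⊔ Y) := by
  induction hX with
  | base X hX => exact h X hX
  | sup_point X p _ ih =>
    refine ⟨ih.1.sup_point hpol ha p, ?_⟩
    rw [sup_right_comm]
    exact .sup_point _ p ih.2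
  | inf_orth_point X p _ ih =>
    refine ⟨ih.1.inf_orth_point hpol ha p, ?_⟩
    rcases ih.1.inf_orth_point_sup hpol ha p with h' | ⟨y, h'⟩
    · rw [h']; exact ih.2
    · rw [h']; exact .inf_orth_point _ y ih.2

theorem FiniteVariant.sup (hpol : o.IsPolarity) (ha : o.IsAnisotropic)
    (hB : o.IsOrthoFamily B) (hX : o.FiniteVariant B X) (hY : o.FiniteVariant B Y) :
    o.SplittingPair X Y ∧ o.FiniteVariant B (X ⊔ Y) := by
  refine hX.sup_of_splittingPair hpol ha fun Z hZ => ?_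
  -- The induction is used twice: here on `Y` against a fixed member of `B`, above on `X` against
  -- the fixed `Y`.
  have := hY.sup_of_splittingPair (Y := Z) hpol ha fun W hW =>
    ⟨⟨hB.splits W hW, hB.splits Z hZ, hB.splits _ (hB.sup_mem W hW Z hZ),
      hB.splits _ (hB.sup_mem _ (hB.orth_mem W hW) _ (hB.orth_mem Z hZ))⟩,
      .base _ (hB.sup_mem W hW Z hZ)⟩
  exact ⟨this.1.symm, sup_comm Y Z ▸ this.2⟩

theorem FiniteVariant.inf (hpol : o.IsPolarity) (ha : o.IsAnisotropic)
    (hB : o.IsOrthoFamily B) (hX : o.FiniteVariant B X) (hY : o.FiniteVariant B Y) :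
    o.FiniteVariant B (X ⊓ Y) := by
  have := ((hX.orth hpol ha hB).sup hpol ha hB (hY.orth hpol ha hB)).2.orth hpol ha hB
  rwa [orth_sup, (hX.splits hpol ha hB).orth_orth ha,
    (hY.splits hpol ha hB).orth_orth ha] at this

/-- The finite variants of an orthogonally closed family form a modular ortholattice. -/
@[reducible]
def finiteVariantLattice (hpol : o.IsPolarity) (ha : o.IsAnisotropic)
    (hB : o.IsOrthoFamily B) : ModularOrtholattice {X // o.FiniteVariant B X} where
  __ := Subtype.lattice (P := o.FiniteVariant B)
    (fun _ _ hX hY => (FiniteVariant.sup hpol ha hB hX hY).2)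
    (fun _ _ hX hY => FiniteVariant.inf hpol ha hB hX hY)
  top := ⟨⊤, by
    have h : o.FiniteVariant B ⊥ := .base _ hB.bot_mem
    have := h.splits hpol ha hB
    rw [Splits, bot_sup_eq] at this
    exact this ▸ h.orth hpol ha hB⟩
  le_top X := (le_top : X.1 ≤ ⊤)
  bot := ⟨⊥, .base _ hB.bot_mem⟩
  bot_le X := (bot_le : ⊥ ≤ X.1)
  compl X := ⟨o.orth X.1, X.2.orth hpol ha hB⟩
  sup_compl_self X := Subtype.ext (X.2.splits hpol ha hB)
  inf_compl_self X := Subtype.ext (inf_orth_self ha X.1)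
  compl_compl_self X := Subtype.ext ((X.2.splits hpol ha hB).orth_orth ha)
  compl_antitone _ _ h := orth_antitone h
  sup_inf_le_assoc_of_le {X} Y {Z} h :=
    IsModularLattice.sup_inf_le_assoc_of_le (x := X.1) Y.1 (z := Z.1) h

/-- An orthogonally closed family of splitting subspaces embeds into an atomic modular
ortholattice of subspaces. -/
theorem IsOrthoFamily.exists_isAtomic (hpol : o.IsPolarity) (ha : o.IsAnisotropic)
    (hB : o.IsOrthoFamily B) :
    ∃ (M : Type u) (_ : ModularOrtholattice M) (e : BoundedLatticeHom M (ProjSubspace P)),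
      IsAtomic M ∧ Function.Injective e ∧ (∀ x, e xᶜ = o.orth (e x)) ∧ ∀ X ∈ B, ∃ x, e x = X := by
  let _ := finiteVariantLattice hpol ha hB
  refine ⟨{X // o.FiniteVariant B X}, finiteVariantLattice hpol ha hB,
    { toFun := Subtype.val, map_sup' := fun _ _ => rfl, map_inf' := fun _ _ => rfl,
      map_top' := rfl, map_bot' := rfl }, ⟨fun X => or_iff_not_imp_left.2 fun hX => ?_⟩,
    Subtype.val_injective, fun _ => rfl, fun X hX => ⟨⟨X, .base X hX⟩, rfl⟩⟩
  obtain ⟨p, hp⟩ : ∃ p, p ∈ X.1 := by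
    by_contra! h
    exact hX (Subtype.ext (le_bot_iff.1 fun p hp => h p hp))
  refine ⟨⟨point p, ?_⟩, ⟨fun h => (isAtom_point p).1 (congrArg Subtype.val h), fun Y hY => ?_⟩,
    point_le.2 hp⟩
  · have := FiniteVariant.sup_point (o := o) ⊥ p (.base (B := B) _ hB.bot_mem)
    rwa [bot_sup_eq] at this
  · exact Subtype.ext ((isAtom_point p).2 Y.1 hY)

end FiniteVariant

end Orthogonality

open Orthogonality in
theorem HasGeometricRepresentation.hasAtomicExtension {L : Type u} [ModularOrtholattice L]
    (h : HasGeometricRepresentation L) : HasAtomicExtension L := by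
  obtain ⟨P, _, o, η, hpol, ha, hinj, hη⟩ := h
  have horth : ∀ a, η aᶜ = o.orth (η a) := fun a =>
    eq_orth_of_sup_eq_top ha (fun q hq p hp => hη a p hp q hq)
      (by rw [← map_sup, Ortholattice.sup_compl_self, map_top])
  have hB : o.IsOrthoFamily (Set.range η) := by
    refine ⟨?_, ⟨⊥, map_bot η⟩, ?_, ?_⟩
    · rintro _ ⟨a, rfl⟩
      rw [Splits, ← horth, ← map_sup, Ortholattice.sup_compl_self, map_top]
    · rintro _ ⟨a, rfl⟩ _ ⟨b, rfl⟩
      exact ⟨a ⊔ b, map_sup η a b⟩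
    · rintro _ ⟨a, rfl⟩
      exact ⟨aᶜ, horth a⟩
  obtain ⟨M, _, e, hM, he, hcompl, hbase⟩ := hB.exists_isAtomic hpol ha
  choose f hf using fun a => hbase (η a) ⟨a, rfl⟩
  refine ⟨M, inferInstance,
    { toFun := f, map_sup' := fun a b => he ?_, map_inf' := fun a b => he ?_,
      map_top' := he ?_, map_bot' := he ?_ }, hM, fun a b hab => hinj ?_, fun a => he ?_⟩
  · simp only [hf, map_sup]
  · simp only [hf, map_inf]
  · simp only [hf, map_top]
  · simp only [hf, map_bot]
  · rw [← hf a, ← hf b]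
    exact congrArg e hab
  · exact (hf _).trans ((horth a).trans (by rw [hcompl]; exact congrArg o.orth (hf a).symm))

end MOL

namespace MOL

/-! ### Projective spaces of atoms -/

/-- A set of atoms of `N` that contains all atoms below the join of two of its members. -/
structure AtomSpace (N : Type u) [ModularOrtholattice N] where
  carrier : Set N
  isAtom : ∀ p ∈ carrier, IsAtom p
  closed : ∀ p ∈ carrier, ∀ q ∈ carrier, ∀ r, IsAtom r → r ≤ p ⊔ q → r ∈ carrier

section AtomTriangle

variable {N : Type u} [ModularOrtholattice N] {p q r s t : N}

theorem not_le_of_isAtom_of_ne (hp : IsAtom p) (hq : IsAtom q) (h : p ≠ q) : ¬ p ≤ q :=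
  fun h' => h ((hq.le_iff_eq hp.1).1 h')

theorem exchange_atoms (hp : IsAtom p) (hq : IsAtom q) (hr : IsAtom r) (h : p ≤ q ⊔ r)
    (hpq : p ≠ q) : r ≤ q ⊔ p :=
  exchange hr h (not_le_of_isAtom_of_ne hp hq hpq)

/-- Since `t ≤ s + (p + r)`, the line `s + t` meets `p + r` in an atom by `isAtom_inf_sup`; the
exchange property excludes the degenerate positions. -/
theorem exists_atom_of_triangle (hp : IsAtom p) (hq : IsAtom q) (hr : IsAtom r) (hs : IsAtom s)
    (ht : IsAtom t) (hsp : s ≠ p) (hsq : s ≠ q) (hpq : p ≠ q) (htq : t ≠ q) (htr : t ≠ r)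
    (hqr : q ≠ r) (hs_le : s ≤ p ⊔ q) (ht_le : t ≤ q ⊔ r) (hp_le : ¬ p ≤ q ⊔ r) :
    ∃ u, IsAtom u ∧ u = (p ⊔ r) ⊓ (s ⊔ t) ∧ s ≠ t ∧ u ≠ p ∧ u ≠ r ∧ u ≠ s ∧ u ≠ t := by
  have hq_ps : q ≤ p ⊔ s := exchange_atoms hs hp hq hs_le hsp
  have hp_qs : p ≤ q ⊔ s := exchange_atoms hs hq hp (by rwa [sup_comm]) hsq
  have hr_qt : r ≤ q ⊔ t := exchange_atoms ht hq hr ht_le htq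
  have hq_rt : q ≤ r ⊔ t := exchange_atoms ht hr hq (by rwa [sup_comm]) htr
  have hr_le : ¬ r ≤ q ⊔ p := fun h => hp_le (exchange_atoms hr hq hp h hqr.symm)
  have hq_le : ¬ q ≤ p ⊔ r := fun h => hr_le (by
    rw [sup_comm]; exact exchange_atoms hq hp hr h hpq.symm)
  have hs_pr : ¬ s ≤ p ⊔ r := fun h => hq_le (hq_ps.trans (sup_le le_sup_left h))
  have ht_pr : ¬ t ≤ p ⊔ r := fun h => hq_le (hq_rt.trans (sup_le le_sup_right h))
  have hst : s ≠ t := by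
    rintro rfl
    exact hp_le (hp_qs.trans (sup_le le_sup_left ht_le))
  have ht_spr : t ≤ s ⊔ (p ⊔ r) := ht_le.trans <| sup_le
    (hq_ps.trans (sup_le (le_sup_left.trans le_sup_right) le_sup_left))
    (le_sup_right.trans le_sup_right)
  refine ⟨_, isAtom_inf_sup hs ht ht_spr hst.symm hs_pr, rfl, hst, fun h => ?_, fun h => ?_,
    fun h => ?_, fun h => ?_⟩
  · have h1 : p ≤ s ⊔ t := h.ge.trans inf_le_right
    have h2 := exchange_atoms hp hs ht h1 hsp.symm
    exact hr_le (hr_qt.trans (sup_le le_sup_left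
      (h2.trans (sup_le (by rwa [sup_comm]) le_sup_right))))
  · have h1 : r ≤ t ⊔ s := by rw [sup_comm]; exact h.ge.trans inf_le_right
    have h2 := exchange_atoms hr ht hs h1 htr.symm
    exact hp_le (hp_qs.trans (sup_le le_sup_left (h2.trans (sup_le ht_le le_sup_right))))
  · exact hs_pr (h.ge.trans inf_le_left)
  · exact ht_pr (h.ge.trans inf_le_left)

end AtomTriangle

namespace AtomSpace

variable {N : Type u} [ModularOrtholattice N] (Q : AtomSpace N)

/-- The points of a space of atoms. -/
def Point : Type u := {p : N // p ∈ Q.carrier}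

variable {Q}

theorem Point.isAtom (p : Q.Point) : IsAtom p.1 := Q.isAtom p.1 p.2

/-- Collinearity of atoms. -/
def Collin (p q r : Q.Point) : Prop := p.1 ≠ q.1 ∧ q.1 ≠ r.1 ∧ p.1 ≠ r.1 ∧ r.1 ≤ p.1 ⊔ q.1

theorem Collin.swap {p q r : Q.Point} (h : Collin p q r) : Collin q p r :=
  ⟨h.1.symm, h.2.2.1, h.2.1, by rw [sup_comm]; exact h.2.2.2⟩

theorem Collin.rotate {p q r : Q.Point} (h : Collin p q r) : Collin q r p :=
  ⟨h.2.1, h.2.2.1.symm, h.1.symm, exchange_atoms r.isAtom q.isAtom p.isAtom h.swap.2.2.2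
    h.2.1.symm⟩

instance : ProjectiveSpace Q.Point where
  Collinear := Collin
  ne_of_collinear h h' := h.1 (congrArg Subtype.val h')
  collinear_swap := Collin.swap
  collinear_rotate := Collin.rotate
  triangle {p q r s t} hs ht hpr hn := by
    have hpr' : p.1 ≠ r.1 := fun h => hpr (Subtype.ext h)
    have hpq : p.1 ≠ q.1 := hs.2.2.1
    have hqr : q.1 ≠ r.1 := ht.2.2.1
    obtain ⟨u, hu, hu_eq, hst, hup, hur, hus, hut⟩ := exists_atom_of_triangle p.isAtom q.isAtom
      r.isAtom s.isAtom t.isAtom hs.1.symm hs.2.1 hpq ht.1.symm ht.2.1 hqr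
      hs.rotate.rotate.swap.2.2.2
      ht.rotate.rotate.swap.2.2.2
      (fun h => hn (Collin.rotate (Collin.rotate ⟨hqr, hpr'.symm, hpq.symm, h⟩)))
    refine ⟨⟨u, Q.closed p.1 p.2 r.1 r.2 u hu (hu_eq.le.trans inf_le_left)⟩,
      ⟨⟨hpr', hur.symm, hup.symm, hu_eq.le.trans inf_le_left⟩,
        ⟨hst, hut.symm, hus.symm, hu_eq.le.trans inf_le_right⟩⟩, fun x hx => Subtype.ext ?_⟩
    refine (hu.le_iff_eq x.isAtom.1).1 ?_
    rw [hu_eq]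
    exact le_inf hx.1.2.2.2 hx.2.2.2.2

/-- The subspace of all points below `a`. -/
def below (Q : AtomSpace N) (a : N) : ProjSubspace Q.Point where
  carrier := {p | p.1 ≤ a}
  closed hp hq h := h.2.2.2.trans (sup_le hp hq)

theorem mem_below {a : N} {p : Q.Point} : p ∈ Q.below a ↔ p.1 ≤ a := Iff.rfl

theorem below_mono {a b : N} (h : a ≤ b) : Q.below a ≤ Q.below b := fun _ hp => le_trans hp h

theorem below_inf (a b : N) : Q.below (a ⊓ b) = Q.below a ⊓ Q.below b :=
  le_antisymm (le_inf (below_mono inf_le_left) (below_mono inf_le_right))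
    fun _ hp => le_inf hp.1 hp.2

theorem below_top : Q.below ⊤ = ⊤ := top_le_iff.1 fun p _ => (le_top : p.1 ≤ ⊤)

theorem below_bot : Q.below ⊥ = ⊥ :=
  le_bot_iff.1 fun p hp => absurd (le_bot_iff.1 (mem_below.1 hp)) p.isAtom.1

theorem mem_sup_of_le_sup {X Y : ProjSubspace Q.Point} {p q r : Q.Point} (hq : q ∈ X) (hr : r ∈ Y)
    (h : p.1 ≤ q.1 ⊔ r.1) : p ∈ X ⊔ Y := by
  by_cases hpq : p.1 = q.1
  · exact mem_sup.2 (Or.inl (Subtype.ext hpq ▸ hq))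
  by_cases hpr : p.1 = r.1
  · exact mem_sup.2 (Or.inr (Or.inl (Subtype.ext hpr ▸ hr)))
  refine mem_sup.2 (Or.inr (Or.inr ⟨q, hq, r, hr, fun hqr => hpq ?_, Ne.symm hpr, Ne.symm hpq, h⟩))
  rw [hqr, sup_idem] at h
  exact ((r.isAtom.le_iff_eq p.isAtom.1).1 h).trans hqr.symm

variable (Q) in
/-- The orthogonality that the orthocomplementation induces. -/
def orthogonality : Orthogonality Q.Point where
  Perp p q := p.1 ≤ q.1ᶜ
  symm := le_compl_comm'
  perp_of_le_sup {p q r s} hq hr hs := by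
    have h : ProjSubspace.point q ⊔ ProjSubspace.point r ≤ Q.below p.1ᶜ :=
      sup_le (point_le.2 (le_compl_comm' hq)) (point_le.2 (le_compl_comm' hr))
    exact le_compl_comm' (point_le.1 (hs.trans h))

theorem isAnisotropic : Q.orthogonality.IsAnisotropic := fun p => not_le_compl_of_isAtom p.isAtom

theorem below_compl_le_orth (a : N) : Q.below aᶜ ≤ Q.orthogonality.orth (Q.below a) :=
  fun _ hq _ hp => le_trans hp (le_compl_comm' hq)

theorem orth_point (p : Q.Point) :
    Q.orthogonality.orth (ProjSubspace.point p) = Q.below p.1ᶜ :=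
  le_antisymm (fun _ hq => le_compl_comm' (hq p rfl))
    fun _ hq => Orthogonality.mem_orth_point.2 (le_compl_comm' hq)

/-- Let `q ∈ X` be outside `p^⊥`. For any other point `r` outside `p^⊥`, the line `qr` meets `p'` in
an atom, which belongs to `Q` by closure under lines and hence to `X`; so `r ∈ X`. -/
theorem isPolarity : Q.orthogonality.IsPolarity := by
  refine ⟨fun p => ⟨p, isAnisotropic p⟩, fun p => ?_⟩
  rw [orth_point]
  refine ⟨fun h => not_le_compl_of_isAtom p.isAtom
    (show p ∈ Q.below p.1ᶜ from h ▸ trivial), fun X hX => ?_⟩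
  obtain ⟨q, hqX, hqp⟩ : ∃ q ∈ X, q ∉ Q.below p.1ᶜ := by
    by_contra! h
    exact hX.not_ge h
  rw [mem_below] at hqp
  have htop : q.1 ⊔ p.1ᶜ = ⊤ := by
    rw [← Ortholattice.compl_compl_self (q.1 ⊔ p.1ᶜ), compl_sup_eq,
      Ortholattice.compl_compl_self, inf_comm,
      (p.isAtom.not_le_iff_disjoint.1 fun h => hqp (le_compl_comm' h)).eq_bot, compl_bot_eq]
  refine top_le_iff.1 fun r _ => ?_
  by_cases hrp : r.1 ≤ p.1ᶜ
  · exact hX.le hrp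
  by_cases hrq : r.1 = q.1
  · exact Subtype.ext hrq ▸ hqX
  have hle : r.1 ≤ q.1 ⊔ p.1ᶜ := htop ▸ le_top
  have hs := isAtom_inf_sup q.isAtom r.isAtom hle hrq hqp
  have heq := sup_inf_sup_of_le hle
  set s := p.1ᶜ ⊓ (q.1 ⊔ r.1)
  have hsp : s ≤ p.1ᶜ := inf_le_left
  let s' : Q.Point := ⟨s, Q.closed _ q.2 _ r.2 s hs inf_le_right⟩
  have hsX : s' ∈ X := hX.le hsp
  exact X.closed hqX hsX ⟨fun h => hqp (h.le.trans hsp), fun h => hrp (h.ge.trans hsp),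
    Ne.symm hrq, heq ▸ le_sup_right⟩

end AtomSpace

theorem HasAtomicExtension.hasGeometricRepresentation {L : Type u} [ModularOrtholattice L]
    (h : HasAtomicExtension L) : HasGeometricRepresentation L := by
  obtain ⟨N, _, f, _, hinj, hcompl⟩ := h
  let Q : AtomSpace N := ⟨{p | IsAtom p}, fun _ h => h, fun _ _ _ _ _ h _ => h⟩
  refine ⟨Q.Point, inferInstance, Q.orthogonality,
    { toFun := fun a => Q.below (f a), map_sup' := fun a b => ?_, map_inf' := fun a b => ?_,
      map_top' := ?_, map_bot' := ?_ }, AtomSpace.isPolarity, AtomSpace.isAnisotropic, ?_, ?_⟩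
  · rw [map_sup]
    refine le_antisymm (fun p hp => ?_) (sup_le (AtomSpace.below_mono le_sup_left)
      (AtomSpace.below_mono le_sup_right))
    by_cases ha : p.1 ≤ f a
    · exact mem_sup.2 (Or.inl ha)
    by_cases hb : p.1 ≤ f b
    · exact mem_sup.2 (Or.inr (Or.inl hb))
    obtain ⟨q, r, hq, hr, hqa, hrb, h⟩ := exists_atoms_of_le_sup p.isAtom hp ha hb
    exact AtomSpace.mem_sup_of_le_sup (q := ⟨q, hq⟩) (r := ⟨r, hr⟩) hqa hrb h
  · rw [map_inf, AtomSpace.below_inf]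
  · rw [map_top, AtomSpace.below_top]
  · rw [map_bot, AtomSpace.below_bot]
  -- Atomicity enters here: an atom below `f a (f a f b)'` would be orthogonal to itself.
  · have key : ∀ a b, Q.below (f a) ≤ Q.below (f b) → f a ≤ f b := fun a b hab => by
      refine le_of_inf_compl_inf_eq_bot ((eq_bot_or_exists_atom_le _).resolve_right ?_)
      rintro ⟨p, hp, hle⟩
      have hpa : p ≤ f a := hle.trans inf_le_left
      have hpb : p ≤ f b := hab (x := ⟨p, hp⟩) hpa
      exact not_le_compl_of_isAtom hp
        ((hle.trans inf_le_right).trans (compl_le_compl' (le_inf hpa hpb)))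
    exact fun a b hab => hinj (le_antisymm (key a b hab.le) (key b a hab.ge))
  · intro a p hp q hq
    refine AtomSpace.below_compl_le_orth (f a) ?_ p hp
    rw [← hcompl]
    exact hq

end MOL

namespace MOL

/-! ### Atomic models of the identities between given elements -/

/-- If the sets of points below the values of terms respect joins, then they are the values of
these terms in an atomic modular ortholattice. -/
theorem AtomSpace.exists_isAtomic_eval {N : Type u} [ModularOrtholattice N] (Q : AtomSpace N)
    (w : ℕ → N) (hsup : ∀ s t : OrthoTerm,
      Q.below ((s.join t).eval w) ≤ Q.below (s.eval w) ⊔ Q.below (t.eval w)) :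
    ∃ (M : Type u) (_ : ModularOrtholattice M) (x : ℕ → M), IsAtomic M ∧
      ∀ t : OrthoTerm, t.eval x = ⊥ ↔ Q.below (t.eval w) = ⊥ := by
  have hsup' : ∀ s t : OrthoTerm,
      Q.below ((s.join t).eval w) = Q.below (s.eval w) ⊔ Q.below (t.eval w) := fun s t =>
    (hsup s t).antisymm (sup_le (below_mono le_sup_left) (below_mono le_sup_right))
  have htop : ∀ t : OrthoTerm, Q.below (t.eval w) ⊔ Q.below (t.compl.eval w) = ⊤ := fun t => by
    rw [← hsup', ← below_top]
    exact congrArg Q.below (Ortholattice.sup_compl_self _)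
  have horth : ∀ t : OrthoTerm,
      Q.below (t.compl.eval w) = Q.orthogonality.orth (Q.below (t.eval w)) := fun t =>
    Orthogonality.eq_orth_of_sup_eq_top isAnisotropic (below_compl_le_orth _) (htop t)
  have hB : Q.orthogonality.IsOrthoFamily (Set.range fun t : OrthoTerm => Q.below (t.eval w)) := by
    refine ⟨?_, ⟨.zero, below_bot⟩, ?_, ?_⟩
    · rintro _ ⟨t, rfl⟩
      have := htop t
      rwa [horth] at this
    · rintro _ ⟨s, rfl⟩ _ ⟨t, rfl⟩
      exact ⟨s.join t, hsup' s t⟩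
    · rintro _ ⟨t, rfl⟩
      exact ⟨t.compl, horth t⟩
  obtain ⟨M, _, e, hM, he, hcompl, hbase⟩ := hB.exists_isAtomic isPolarity isAnisotropic
  choose x hx using fun n => hbase (Q.below (w n)) ⟨.var n, rfl⟩
  have key : ∀ t : OrthoTerm, e (t.eval x) = Q.below (t.eval w) := fun t => by
    induction t with
    | var n => exact hx n
    | zero => exact (map_bot e).trans below_bot.symm
    | one => exact (map_top e).trans below_top.symm
    | join s t hs ht => rw [hsup', ← hs, ← ht, ← map_sup]; rfl
    | meet s t hs ht => simp only [OrthoTerm.eval, map_inf, hs, ht, below_inf]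
    | compl s hs => rw [horth, ← hs, ← hcompl]; rfl
  exact ⟨M, inferInstance, x, hM, fun t => by rw [← key, ← he.eq_iff, map_bot]⟩

/-- Countable saturation of ultraproducts. -/
theorem exists_forall_eventually {U : Filter ℕ} (hU : U ≤ Filter.atTop) {X : ℕ → Type*}
    [∀ n, Nonempty (X n)] (R : ∀ n, X n → ℕ → Prop)
    (hR : ∀ n x k l, k ≤ l → R n x l → R n x k) (h : ∀ k, ∀ᶠ n in U, ∃ x, R n x k) :
    ∃ x : ∀ n, X n, ∀ k, ∀ᶠ n in U, R n (x n) k := by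
  -- A witness for the largest solvable `k ≤ m` serves all smaller `k` as well. Taking `m = n`
  -- afterwards covers each `k` at almost all `n`.
  have key : ∀ n m, ∃ x : X n, ∀ k ≤ m, (∃ y, R n y k) → R n x k := fun n m => by
    induction m with
    | zero =>
      by_cases h0 : ∃ y, R n y 0
      · obtain ⟨y, hy⟩ := h0
        exact ⟨y, fun k hk _ => hR n y k 0 hk hy⟩
      · exact ⟨Classical.arbitrary _, fun k hk h' => absurd (Nat.le_zero.1 hk ▸ h') h0⟩
    | succ m ih =>
      by_cases h0 : ∃ y, R n y (m + 1)
      · obtain ⟨y, hy⟩ := h0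
        exact ⟨y, fun k hk _ => hR n y k (m + 1) hk hy⟩
      · obtain ⟨x, hx⟩ := ih
        refine ⟨x, fun k hk h' => ?_⟩
        rcases Nat.le_succ_iff.1 hk with hk | rfl
        · exact hx k hk h'
        · exact absurd h' h0
  choose x hx using fun n => key n n
  refine ⟨x, fun k => ?_⟩
  filter_upwards [h k, hU (Filter.eventually_ge_atTop k)] with n hn hkn
  exact hx n k hkn hn

/-- The join of the first terms of a sequence. -/
def OrthoTerm.joinUpTo (e : ℕ → OrthoTerm) : ℕ → OrthoTerm
  | 0 => e 0
  | n + 1 => .join (joinUpTo e n) (e (n + 1))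

namespace OrthoTerm

variable {L : Type*} [Ortholattice L] (e : ℕ → OrthoTerm) (v : ℕ → L)

theorem eval_joinUpTo_mono : Monotone fun n => (joinUpTo e n).eval v :=
  monotone_nat_of_le_succ fun _ => le_sup_left

theorem eval_le_joinUpTo (n : ℕ) : (e n).eval v ≤ (joinUpTo e n).eval v := by
  cases n with
  | zero => exact le_rfl
  | succ n => exact le_sup_right

theorem eval_joinUpTo_eq_bot (h : ∀ n, (e n).eval v = ⊥) (n : ℕ) :
    (joinUpTo e n).eval v = ⊥ := by
  induction n with
  | zero => exact h 0
  | succ n ih => simp only [joinUpTo, eval, ih, h, sup_bot_eq]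

end OrthoTerm

/-! ### From proatomic lattices to atomic extensions -/

section Models

variable {L : Type u} [ModularOrtholattice L]

theorem IsProatomic.exists_eval_ne_bot (hL : IsProatomic L) {v : ℕ → L} {t : OrthoTerm}
    (h : t.eval v ≠ ⊥) : ∃ (M : Type u) (_ : ModularOrtholattice M) (w : ℕ → M),
      IsAtomic M ∧ t.eval w ≠ ⊥ := by
  by_contra! hcon
  exact h (hL t .zero (fun M _ hM w => hcon M inferInstance w hM.isAtomic) v)

/-- As `c` vanishes at `v`, the terms `b c'` and `b` agree there, so each `b` has its own atomic
model; the product of these serves all `b` at once. -/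
theorem IsProatomic.exists_forall_eval_meet_compl_ne_bot (hL : IsProatomic L) (v : ℕ → L)
    {c : OrthoTerm} (hc : c.eval v = ⊥) :
    ∃ (M : Type u) (_ : ModularOrtholattice M) (w : ℕ → M), IsAtomic M ∧
      ∀ b : OrthoTerm, b.eval v ≠ ⊥ → (b.meet c.compl).eval w ≠ ⊥ := by
  have key : ∀ b : {b : OrthoTerm // b.eval v ≠ ⊥}, ∃ (M : Type u) (_ : ModularOrtholattice M)
      (w : ℕ → M), IsAtomic M ∧ (b.1.meet c.compl).eval w ≠ ⊥ := fun b => by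
    apply hL.exists_eval_ne_bot (v := v)
    simpa only [OrthoTerm.eval, hc, compl_bot_eq, inf_top_eq] using b.2
  choose M inst w hM hw using key
  refine ⟨∀ b, M b, inferInstance, fun n b => w b n, inferInstance, fun b hb h => ?_⟩
  apply hw ⟨b, hb⟩
  rw [← OrthoTerm.eval_pi (fun n b => w b n), h]
  rfl

/-- The atoms that are orthogonal to all values of terms that vanish at `v`. -/
def residualAtoms (v : ℕ → L) {N : Type u} [ModularOrtholattice N] (w : ℕ → N) : AtomSpace N where
  carrier := {p | IsAtom p ∧ ∀ t : OrthoTerm, t.eval v = ⊥ → p ≤ (t.eval w)ᶜ}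
  isAtom _ h := h.1
  closed _ hp _ hq _ hr hle := ⟨hr, fun t ht => hle.trans (sup_le (hp.2 t ht) (hq.2 t ht))⟩

/-- The term `s(st)'` vanishes at `v`, so the atom lies below `s(s(st)')' = st`. Hence the residual
atoms below a term depend only on its value in `L`. -/
theorem residualAtoms_le_of_le {v : ℕ → L} {N : Type u} [ModularOrtholattice N] {w : ℕ → N}
    {s t : OrthoTerm} (h : s.eval v ≤ t.eval v) (p : (residualAtoms v w).Point)
    (hp : p.1 ≤ s.eval w) : p.1 ≤ t.eval w := by
  have h1 : p.1 ≤ s.eval w ⊓ ((s.diff t).eval w)ᶜ :=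
    le_inf hp (p.2.2 _ (OrthoTerm.eval_diff_eq_bot.2 h))
  rw [OrthoTerm.diff, OrthoTerm.eval, OrthoTerm.eval, OrthoTerm.eval,
    inf_compl_inf_compl_of_le inf_le_left] at h1
  exact h1.trans inf_le_right

theorem IsProatomic.exists_isAtomic_eval (hL : IsProatomic L) (v : ℕ → L) :
    ∃ (M : Type u) (_ : ModularOrtholattice M) (w : ℕ → M), IsAtomic M ∧
      ∀ t : OrthoTerm, t.eval w = ⊥ ↔ t.eval v = ⊥ := by
  obtain ⟨e, he⟩ := (Set.to_countable {t : OrthoTerm | t.eval v = ⊥}).exists_eq_range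
    ⟨.zero, rfl⟩
  have he' : ∀ n, (e n).eval v = ⊥ := fun n => he.ge ⟨n, rfl⟩
  set A := OrthoTerm.joinUpTo e
  have hA : ∀ n, (A n).eval v = ⊥ := OrthoTerm.eval_joinUpTo_eq_bot e v he'
  choose M inst w hM hw using fun n => hL.exists_forall_eval_meet_compl_ne_bot v (hA n)
  let U : Ultrafilter ℕ := Filter.hyperfilter ℕ
  have hU : (U : Filter ℕ) ≤ Filter.atTop := Nat.hyperfilter_le_atTop
  let W : ℕ → Ultraproduct U M := fun i => Ultraproduct.mk U fun n => w n i
  have hW : ∀ t : OrthoTerm, t.eval W = Ultraproduct.mk U fun n => t.eval (w n) :=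
    Ultraproduct.eval_mk _
  let Q := residualAtoms v W
  have memQ : ∀ p : ∀ n, M n, (∀ᶠ n in U, IsAtom (p n)) →
      (∀ k, ∀ᶠ n in U, p n ≤ ((A k).eval (w n))ᶜ) → Ultraproduct.mk U p ∈ Q.carrier := by
    refine fun p hp hle => ⟨Ultraproduct.isAtom_mk.2 hp, fun t ht => ?_⟩
    obtain ⟨k, rfl⟩ := he.le ht
    rw [hW, Ultraproduct.mk_compl, Ultraproduct.mk_le]
    exact (hle k).mono fun n h => h.trans (compl_le_compl' (OrthoTerm.eval_le_joinUpTo e _ k))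
  have hsup : ∀ s t : OrthoTerm,
      Q.below ((s.join t).eval W) ≤ Q.below (s.eval W) ⊔ Q.below (t.eval W) := by
    intro s t p hp
    by_cases hps : p.1 ≤ s.eval W
    · exact mem_sup.2 (Or.inl hps)
    by_cases hpt : p.1 ≤ t.eval W
    · exact mem_sup.2 (Or.inr (Or.inl hpt))
    -- At `v` the factors `(A k)'` are `1`, so residual atoms do not notice them. For each `k` this
    -- yields a splitting of `p` into atoms orthogonal to `A k`; saturation then gives one for all
    -- `k`.
    have hpk : ∀ k, p.1 ≤ ((s.meet (A k).compl).join (t.meet (A k).compl)).eval W := fun k =>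
      residualAtoms_le_of_le (s := s.join t)
        (by simp only [OrthoTerm.eval, hA, compl_bot_eq, inf_top_eq, le_refl]) p hp
    obtain ⟨f, hf⟩ := Ultraproduct.exists_mk p.1
    have hfatom : ∀ᶠ n in U, IsAtom (f n) := Ultraproduct.isAtom_mk.1 (hf ▸ p.isAtom)
    simp only [← hf, hW, Ultraproduct.mk_le] at hps hpt hpk
    rw [← Ultrafilter.eventually_not] at hps hpt
    obtain ⟨x, hx⟩ := exists_forall_eventually hU (X := fun n => M n × M n)
      (fun n x k => IsAtom x.1 ∧ IsAtom x.2 ∧ x.1 ≤ (s.meet (A k).compl).eval (w n) ∧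
        x.2 ≤ (t.meet (A k).compl).eval (w n) ∧ f n ≤ x.1 ⊔ x.2)
      (fun n x k l hkl h => by
        have hc := compl_le_compl' (OrthoTerm.eval_joinUpTo_mono e (w n) hkl)
        exact ⟨h.1, h.2.1, h.2.2.1.trans (inf_le_inf_left _ hc),
          h.2.2.2.1.trans (inf_le_inf_left _ hc), h.2.2.2.2⟩)
      (fun k => by
        filter_upwards [hfatom, hps, hpt, hpk k] with n h1 h2 h3 h4
        obtain ⟨q, r, h⟩ := exists_atoms_of_le_sup h1 h4 (fun h => h2 (h.trans inf_le_left))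
          (fun h => h3 (h.trans inf_le_left))
        exact ⟨(q, r), h⟩)
    have hq := memQ (fun n => (x n).1) ((hx 0).mono fun n h => h.1)
      fun k => (hx k).mono fun n h => h.2.2.1.trans inf_le_right
    have hr := memQ (fun n => (x n).2) ((hx 0).mono fun n h => h.2.1)
      fun k => (hx k).mono fun n h => h.2.2.2.1.trans inf_le_right
    refine AtomSpace.mem_sup_of_le_sup (q := ⟨_, hq⟩) (r := ⟨_, hr⟩) ?_ ?_ ?_
    · change (Ultraproduct.mk U fun n => (x n).1) ≤ s.eval W
      rw [hW]
      exact (hx 0).mono fun n h => h.2.2.1.trans inf_le_left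
    · change (Ultraproduct.mk U fun n => (x n).2) ≤ t.eval W
      rw [hW]
      exact (hx 0).mono fun n h => h.2.2.2.1.trans inf_le_left
    · rw [← hf]
      exact (hx 0).mono fun n h => h.2.2.2.2
  obtain ⟨N, _, x, hN, hx⟩ := Q.exists_isAtomic_eval W hsup
  refine ⟨N, inferInstance, x, hN, fun t => (hx t).trans ⟨fun h => ?_, fun h => ?_⟩⟩
  · by_contra ht
    -- The `n`-th atom is orthogonal to `A n`, hence to `A k` for all `k ≤ n`, so the diagonal class
    -- is residual.
    choose p hp hle using fun n => (eq_bot_or_exists_atom_le _).resolve_left (hw n t ht)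
    have hpQ := memQ p (.of_forall hp) fun k => by
      filter_upwards [hU (Filter.eventually_ge_atTop k)] with n hkn
      exact (hle n).trans (inf_le_right.trans
        (compl_le_compl' (OrthoTerm.eval_joinUpTo_mono e (w n) hkn)))
    have hmem : (⟨_, hpQ⟩ : Q.Point) ∈ Q.below (t.eval W) := by
      change Ultraproduct.mk U p ≤ t.eval W
      rw [hW]
      exact .of_forall fun n => (hle n).trans inf_le_left
    rw [h] at hmem
    exact hmem
  · rw [← AtomSpace.below_bot]
    refine le_antisymm (fun p hp => ?_) (AtomSpace.below_mono bot_le)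
    exact residualAtoms_le_of_le (t := .zero) h.le p hp

theorem eval_eq_iff_of_eval_eq_bot_iff {M : Type*} [ModularOrtholattice M] {v : ℕ → L} {w : ℕ → M}
    (h : ∀ t : OrthoTerm, t.eval w = ⊥ ↔ t.eval v = ⊥) (s t : OrthoTerm) :
    s.eval w = t.eval w ↔ s.eval v = t.eval v := by
  rw [le_antisymm_iff, le_antisymm_iff, ← OrthoTerm.eval_diff_eq_bot, ← OrthoTerm.eval_diff_eq_bot,
    h, h, OrthoTerm.eval_diff_eq_bot, OrthoTerm.eval_diff_eq_bot]

theorem IsProatomic.exists_isAtomic_finset (hL : IsProatomic L) (S : Finset L) :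
    ∃ (M : Type u) (_ : ModularOrtholattice M) (f : L → M), IsAtomic M ∧
      (∀ a ∈ S, ∀ b ∈ S, f a = f b → a = b) ∧
      (∀ a ∈ S, ∀ b ∈ S, a ⊔ b ∈ S → f (a ⊔ b) = f a ⊔ f b) ∧
      (∀ a ∈ S, ∀ b ∈ S, a ⊓ b ∈ S → f (a ⊓ b) = f a ⊓ f b) ∧
      (∀ a ∈ S, aᶜ ∈ S → f aᶜ = (f a)ᶜ) ∧ (⊥ ∈ S → f ⊥ = ⊥) ∧ (⊤ ∈ S → f ⊤ = ⊤) := by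
  -- Inserting `⊥` makes the set nonempty, so that a sequence can enumerate it.
  obtain ⟨v, hv⟩ := (Set.to_countable (insert ⊥ (S : Set L))).exists_eq_range
    (Set.insert_nonempty _ _)
  obtain ⟨M, _, w, hM, hw⟩ := hL.exists_isAtomic_eval v
  have key := eval_eq_iff_of_eval_eq_bot_iff hw
  have hf : ∀ a, ∃ x : M, a ∈ S → ∃ n, v n = a ∧ w n = x := fun a => by
    by_cases ha : a ∈ S
    · obtain ⟨n, hn⟩ := hv.le (Set.mem_insert_of_mem _ ha)
      exact ⟨w n, fun _ => ⟨n, hn, rfl⟩⟩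
    · exact ⟨⊥, fun h => absurd h ha⟩
  choose f hf using hf
  refine ⟨M, inferInstance, f, hM, fun a ha b hb hab => ?_, fun a ha b hb hab => ?_,
    fun a ha b hb hab => ?_, fun a ha hac => ?_, fun h => ?_, fun h => ?_⟩
  · obtain ⟨i, rfl, hi⟩ := hf a ha
    obtain ⟨j, rfl, hj⟩ := hf b hb
    exact (key (.var i) (.var j)).1 (hi.trans (hab.trans hj.symm))
  · obtain ⟨k, hk, hk'⟩ := hf _ hab
    obtain ⟨i, hi, hi'⟩ := hf a ha
    obtain ⟨j, hj, hj'⟩ := hf b hb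
    rw [← hk', ← hi', ← hj']
    exact (key (.var k) (.join (.var i) (.var j))).2 (by simp only [OrthoTerm.eval, hi, hj, hk])
  · obtain ⟨k, hk, hk'⟩ := hf _ hab
    obtain ⟨i, hi, hi'⟩ := hf a ha
    obtain ⟨j, hj, hj'⟩ := hf b hb
    rw [← hk', ← hi', ← hj']
    exact (key (.var k) (.meet (.var i) (.var j))).2 (by simp only [OrthoTerm.eval, hi, hj, hk])
  · obtain ⟨k, hk, hk'⟩ := hf _ hac
    obtain ⟨i, hi, hi'⟩ := hf a ha
    rw [← hk', ← hi']
    exact (key (.var k) (.compl (.var i))).2 (by simp only [OrthoTerm.eval, hi, hk])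
  · obtain ⟨k, hk, hk'⟩ := hf _ h
    rw [← hk']
    exact (key (.var k) .zero).2 hk
  · obtain ⟨k, hk, hk'⟩ := hf _ h
    rw [← hk']
    exact (key (.var k) .one).2 hk

/-- For an ultrafilter finer than `atTop` on the finite subsets, almost every `S` contains any given
elements, so the partial embeddings of the sets `S` fit together to an embedding into the
ultraproduct. -/
theorem IsProatomic.hasAtomicExtension (hL : IsProatomic L) : HasAtomicExtension L := by
  choose M inst f hM hinj hsup hinf hcompl hbot htop using hL.exists_isAtomic_finset
  let U : Ultrafilter (Finset L) := Ultrafilter.of Filter.atTop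
  have hU : ∀ a : L, ∀ᶠ S in U, a ∈ S := fun a => by
    have h : ∀ᶠ S : Finset L in Filter.atTop, {a} ≤ S := Filter.eventually_ge_atTop {a}
    exact (h.filter_mono (Ultrafilter.of_le Filter.atTop)).mono
      fun S hS => Finset.singleton_subset_iff.1 hS
  refine ⟨Ultraproduct U M, inferInstance,
    { toFun := fun a => Ultraproduct.mk U fun S => f S a
      map_sup' := fun a b => ?_
      map_inf' := fun a b => ?_
      map_top' := ?_
      map_bot' := ?_ }, inferInstance, fun a b hab => ?_, fun a => ?_⟩
  · refine Ultraproduct.mk_eq.2 ?_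
    filter_upwards [hU a, hU b, hU (a ⊔ b)] with S h1 h2 h3 using hsup S a h1 b h2 h3
  · refine Ultraproduct.mk_eq.2 ?_
    filter_upwards [hU a, hU b, hU (a ⊓ b)] with S h1 h2 h3 using hinf S a h1 b h2 h3
  · exact Ultraproduct.mk_eq.2 ((hU ⊤).mono htop)
  · exact Ultraproduct.mk_eq.2 ((hU ⊥).mono hbot)
  · obtain ⟨S, h1, h2, h3⟩ := ((hU a).and ((hU b).and (Ultraproduct.mk_eq.1 hab))).exists
    exact hinj S a h1 b h2 h3
  · refine Ultraproduct.mk_eq.2 ?_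
    filter_upwards [hU a, hU aᶜ] with S h1 h2 using hcompl S a h1 h2

end Models

end MOL

theorem theorem1p1 (L : Type u) [MOL.ModularOrtholattice L] :
    List.TFAE [MOL.IsProatomic L, MOL.HasAtomicExtension L,
      MOL.HasGeometricRepresentation L] := by
  tfae_have 1 → 2 := MOL.IsProatomic.hasAtomicExtension
  tfae_have 2 → 1 := MOL.HasAtomicExtension.isProatomic
  tfae_have 2 → 3 := MOL.HasAtomicExtension.hasGeometricRepresentation
  tfae_have 3 → 2 := MOL.HasGeometricRepresentation.hasAtomicExtension
  tfae_finish
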